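/- All graphs are finite, simple and undirected. A graph is distance-hereditary if the distances in every connected induced subgraph are the same as in the whole graph. A $(2,1)$-graph is a graph whose vertex set can be partitioned into two stable sets and one clique (parts may be empty). Consider the following four graphs: - $G_1 = 2K_3$, the disjoint union of two triangles; - $G_5$, the join of two non-adjacent vertices with $2K_2$ (the disjoint union of two edges); - $G_6$, the join of two non-adjacent vertices with the chordless cycle $C_4$, that is, the octahedron $K_{2,2,2}$; - $G_7$, the graph with vertices $x,y,a,b,u,r,s$ and edges $xy, xa, xb, ya, yb, au, bu, ur, us, rs$. Let $G$ be a distance-hereditary graph. Then $G$ is a $(2,1)$-graph if and only if $G$ is $(G_1,G_5,G_6,G_7)$-free, i.e. no induced subgraph of $G$ is isomorphic to one of $G_1,G_5,G_6,G_7$. -/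

import Mathlib

/-- A graph is distance-hereditary if distances in every connected induced subgraph are the same as
in the whole graph. -/
def IsDistanceHereditary {V : Type*} (G : SimpleGraph V) : Prop :=
  ∀ S : Set V, (G.induce S).Connected →
    ∀ u v : S, (G.induce S).dist u v = G.dist (u : V) (v : V)

/-- A `(2,1)`-graph: the vertex set can be partitioned into two stable sets and one clique (any of
the three parts may be empty). -/
def IsTwoOneGraph {V : Type*} (G : SimpleGraph V) : Prop :=
  ∃ A B Q : Set V, A ∪ B ∪ Q = Set.univ ∧ Disjoint A B ∧ Disjoint A Q ∧ Disjoint B Q ∧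
    G.IsIndepSet A ∧ G.IsIndepSet B ∧ G.IsClique Q

/-- `G` is `H`-free: no induced subgraph of `G` is isomorphic to `H`. -/
def IsInducedFree {V W : Type*} (H : SimpleGraph W) (G : SimpleGraph V) : Prop :=
  ∀ S : Set V, IsEmpty (H ≃g G.induce S)

/-- `G₁`, the disjoint union of two triangles. -/
def graphG1 : SimpleGraph (Fin 6) :=
  SimpleGraph.fromEdgeSet {s(0, 1), s(0, 2), s(1, 2), s(3, 4), s(3, 5), s(4, 5)}

/-- `G₅`, the join of two non-adjacent vertices `0, 1` with the disjoint union of the two edges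
`23` and `45`. -/
def graphG5 : SimpleGraph (Fin 6) :=
  SimpleGraph.fromEdgeSet {s(2, 3), s(4, 5),
    s(0, 2), s(0, 3), s(0, 4), s(0, 5), s(1, 2), s(1, 3), s(1, 4), s(1, 5)}

/-- `G₆`, the join of two non-adjacent vertices `0, 1` with the chordless cycle `2345`
(the octahedron `K_{2,2,2}`). -/
def graphG6 : SimpleGraph (Fin 6) :=
  SimpleGraph.fromEdgeSet {s(2, 3), s(3, 4), s(4, 5), s(2, 5),
    s(0, 2), s(0, 3), s(0, 4), s(0, 5), s(1, 2), s(1, 3), s(1, 4), s(1, 5)}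

/-- `G₇`: two triangles `012` and `013` sharing the edge `01`, and a triangle `456` whose vertex `4`
is adjacent to the two non-adjacent vertices `2` and `3`. -/
def graphG7 : SimpleGraph (Fin 7) :=
  SimpleGraph.fromEdgeSet {s(0, 1), s(0, 2), s(1, 2), s(0, 3), s(1, 3),
    s(2, 4), s(3, 4), s(4, 5), s(4, 6), s(5, 6)}

/-! A $(2,1)$-partition yields a clique meeting every triangle, and no clique does so in
$G_1,G_5,G_6,G_7$. For the converse, it suffices to find such a clique: what remains is
triangle-free, and a triangle-free set in a distance-hereditary graph is bipartite, coloured by the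
parity of the distance to a root in each component (`IsDistanceHereditary.exists_indep_partition`).
The search for the clique uses distance-heredity only through `HasUniformAttachment`.

Take a minimal vertex set `W` without such a clique; each of its vertices lies in a triangle. If any
two non-adjacent vertices of `W` have a common neighbour in `W`, then `W` is `P₄`-free and
decomposes as a disjoint union or a join. In a union, excluding $2K_3$ leaves triangles in only one
part. In a join without a universal vertex, both parts are threshold, hence split, and the cliques
of the two splittings unite (`ForbidsObstructions.hasTransversal_of_isPathFourFreeOn`).

Otherwise two vertices are far apart, and uniform attachment cuts `W` into two sides `X ∪ S` and `D
∪ E` joined exactly by the complete pair `S`, `D` (`IsSplitObstruction`). If neither `S` nor `D` is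
a clique, both are threshold, and suitable splittings again give a clique meeting all triangles. If
`D` is a clique, then minimality makes `S` a non-clique, and `S` is `P₄`-free, so it is a union or a
join; both cases are impossible. The case of `S` is symmetric. -/

/-! ### Metric consequences of distance-heredity -/

/-- Two vertices of a connected set `K` that avoids the closed neighbourhood of `x` and that both
have neighbours in the neighbourhood of `x` have the same neighbours there. -/
def HasUniformAttachment {V : Type*} (G : SimpleGraph V) : Prop :=
  ∀ (x : V) (K : Set V), (G.induce K).Preconnected → (∀ k ∈ K, k ≠ x ∧ ¬ G.Adj x k) →
    ∀ u ∈ K, ∀ v ∈ K, ∀ a b, G.Adj x a → G.Adj a u → G.Adj x b → G.Adj b v → G.Adj a v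

lemma connected_induce_insert {V : Type*} {G : SimpleGraph V} {K : Set V}
    (hK : (G.induce K).Preconnected) {a u : V} (hu : u ∈ K) (hau : G.Adj a u) :
    (G.induce (insert a K)).Connected := by
  have key : ∀ w : (insert a K : Set V), (G.induce (insert a K)).Reachable
      ⟨u, Set.mem_insert_of_mem _ hu⟩ w := by
    rintro ⟨w, rfl | hw⟩
    · exact SimpleGraph.Adj.reachable (by simpa using hau.symm)
    · exact (hK ⟨u, hu⟩ ⟨w, hw⟩).map
        (SimpleGraph.induceHomOfLE G (Set.subset_insert a K)).toHom
  have : Nonempty (insert a K : Set V) := ⟨⟨a, Set.mem_insert _ _⟩⟩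
  exact ⟨fun v w => (key v).symm.trans (key w)⟩

/-- In the subgraph induced on `K` together with `a` and `x`, the only neighbour of `x` is `a`. The
path through `b` puts `v` at distance two from `x` in `G`, so distance two must already be realised
through `a`. -/
lemma IsDistanceHereditary.hasUniformAttachment {V : Type*} {G : SimpleGraph V}
    (hG : IsDistanceHereditary G) : HasUniformAttachment G := by
  intro x K hK hx u hu v hv a b hxa hau hxb hbv
  have h1 := connected_induce_insert hK hu hau
  have h2 := connected_induce_insert h1.preconnected (Set.mem_insert a K) hxa
  have hd := hG _ h2 ⟨x, Set.mem_insert _ _⟩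
    ⟨v, Set.mem_insert_of_mem _ (Set.mem_insert_of_mem _ hv)⟩
  have hle : G.dist x v ≤ 2 :=
    SimpleGraph.dist_le (SimpleGraph.Walk.cons hxb (SimpleGraph.Walk.cons hbv .nil))
  obtain ⟨p, hp⟩ := h2.exists_walk_length_eq_dist ⟨x, Set.mem_insert _ _⟩
    ⟨v, Set.mem_insert_of_mem _ (Set.mem_insert_of_mem _ hv)⟩
  rw [hd] at hp
  match p, hp with
  | .nil, _ => exact absurd rfl (hx x hv).1
  | .cons h .nil, _ => exact absurd (by simpa using h) (hx v hv).2
  | .cons (v := ⟨w, hw⟩) h (.cons h' .nil), _ =>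
    rcases hw with rfl | rfl | hw
    · exact absurd h (by simp)
    · simpa using h'
    · exact absurd (by simpa using h) (hx w hw).2
  | .cons _ (.cons _ (.cons _ _)), hp =>
    simp only [SimpleGraph.Walk.length_cons] at hp
    omega

lemma HasUniformAttachment.of_adj {V : Type*} {G : SimpleGraph V} (hG : HasUniformAttachment G)
    {x u v a b : V} (hxu : ¬ G.Adj x u) (hxv : ¬ G.Adj x v) (hux : u ≠ x) (hvx : v ≠ x)
    (huv : G.Adj u v) (hxa : G.Adj x a) (hau : G.Adj a u) (hxb : G.Adj x b) (hbv : G.Adj b v) :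
    G.Adj a v := by
  refine hG x {u, v} (SimpleGraph.induce_pair_connected_of_adj huv).preconnected ?_ u (by simp)
    v (by simp) a b hxa hau hxb hbv
  rintro k (rfl | rfl)
  · exact ⟨hux, hxu⟩
  · exact ⟨hvx, hxv⟩

/-- The ends of an induced `P₄` have no common neighbour. -/
lemma HasUniformAttachment.path_four {V : Type*} {G : SimpleGraph V} (hG : HasUniformAttachment G)
    {p q r s e : V} (hpq : G.Adj p q) (hqr : G.Adj q r) (hrs : G.Adj r s) (hpr : ¬ G.Adj p r)
    (hps : ¬ G.Adj p s) (hqs : ¬ G.Adj q s) (hep : G.Adj e p) (hes : G.Adj e s) : False := by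
  refine hqs (hG.of_adj hpr hps ?_ ?_ hrs hpq hqr hep.symm hes)
  · rintro rfl; exact hps hrs
  · rintro rfl; exact hpr hrs.symm

/-- No three vertices of `W` are pairwise adjacent. -/
def TriangleFreeOn {V : Type*} (G : SimpleGraph V) (W : Set V) : Prop :=
  ∀ a ∈ W, ∀ b ∈ W, ∀ c ∈ W, G.Adj a b → G.Adj a c → G.Adj b c → False

/-- Were the distances equal, add `u` to a shortest path from `r` to `v` inside `K`.
Distance-heredity gives a shortest path from `u` to `r` in this set; its second vertex `w` must be
the neighbour of `v` on the path, and `u`, `v`, `w` form a triangle. -/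
lemma IsDistanceHereditary.dist_ne_of_triangleFreeOn {V : Type*} {G : SimpleGraph V}
    (hG : IsDistanceHereditary G) {K : Set V} (hK : (G.induce K).Connected)
    (hT : TriangleFreeOn G K) {r u v : V} (hr : r ∈ K) (hu : u ∈ K) (hv : v ∈ K)
    (huv : G.Adj u v) : G.dist r u ≠ G.dist r v := by
  intro hd
  obtain ⟨p, hp⟩ := hK.exists_walk_length_eq_dist ⟨r, hr⟩ ⟨v, hv⟩
  rw [hG _ hK] at hp
  let p' : G.Walk r v := p.map (SimpleGraph.Embedding.induce K).toHom
  have hp' : p'.length = G.dist r v := (p.length_map _).trans hp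
  have hsub : ∀ w ∈ p'.support, w ∈ K := by
    intro w hw
    obtain ⟨⟨z, hz⟩, -, rfl⟩ := List.mem_map.1 ((p.support_map _) ▸ hw)
    exact hz
  have hS := connected_induce_insert p'.connected_induce_support.preconnected
    (p'.end_mem_support) huv
  have hrS : r ∈ insert u {w | w ∈ p'.support} := Set.mem_insert_of_mem _ p'.start_mem_support
  have huS : u ∈ insert u {w | w ∈ p'.support} := Set.mem_insert _ _
  obtain ⟨q, hq⟩ := hS.exists_walk_length_eq_dist ⟨u, huS⟩ ⟨r, hrS⟩
  rw [hG _ hS] at hq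
  cases q with
  | nil =>
    have h0 : G.dist r v = 0 := by rw [← hd]; simp
    have : r = v := (p'.reachable.dist_eq_zero_iff).1 h0
    exact huv.ne this
  | @cons _ w _ h q =>
    obtain ⟨w, hw⟩ := w
    have huw : G.Adj u w := h
    have hle : G.dist w r ≤ q.length := by
      have := SimpleGraph.dist_le (q.map (SimpleGraph.Embedding.induce _).toHom)
      rwa [SimpleGraph.Walk.length_map] at this
    simp only [SimpleGraph.Walk.length_cons] at hq
    rcases hw with rfl | hw
    · exact huw.ne rfl
    have hw : w ∈ p'.support := hw
    classical
    have hlen := congrArg SimpleGraph.Walk.length (p'.take_spec hw)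
    rw [SimpleGraph.Walk.length_append] at hlen
    have h1 := SimpleGraph.dist_le (SimpleGraph.Walk.cons huw (p'.takeUntil w hw).reverse)
    simp only [SimpleGraph.Walk.length_cons, SimpleGraph.Walk.length_reverse] at h1
    have h5 : G.dist u r = G.dist r v := by rw [SimpleGraph.dist_comm, hd]
    -- Since `u` is one step from `w`, the part of `p'` before `w` is at most one shorter than `p'`.
    have h6 : (p'.dropUntil w hw).length ≤ 1 := by omega
    have hwv : w ≠ v := by
      rintro rfl
      rw [SimpleGraph.dist_comm] at hle
      omega
    have h7 : G.Adj w v := by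
      rcases Nat.le_one_iff_eq_zero_or_eq_one.1 h6 with h | h
      · exact absurd (SimpleGraph.Walk.eq_of_length_eq_zero h) hwv
      · exact SimpleGraph.Walk.adj_of_length_eq_one h
    exact hT u hu v hv w (hsub w hw) huv huw h7.symm

/-- A triangle-free set of vertices of a distance-hereditary graph splits into two stable sets. -/
lemma IsDistanceHereditary.exists_indep_partition {V : Type*} {G : SimpleGraph V}
    (hG : IsDistanceHereditary G) {W : Set V} (hT : TriangleFreeOn G W) :
    ∃ A B : Set V, A ∪ B = W ∧ Disjoint A B ∧ G.IsIndepSet A ∧ G.IsIndepSet B := by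
  let root : W → W := fun v => ((G.induce W).connectedComponentMk v).out
  have hroot : ∀ v, (G.induce W).Reachable (root v) v := fun v =>
    SimpleGraph.ConnectedComponent.exact (Quot.out_eq _)
  -- Parity of `f` is the colouring: along an edge of `W`, `f` changes by at most one, and it does
  -- change by `dist_ne_of_triangleFreeOn`.
  let f : W → ℕ := fun v => G.dist (root v : V) v
  have key : ∀ u v : W, G.Adj u v → f u % 2 ≠ f v % 2 := by
    intro u v huv
    have hr : root u = root v := by
      have : (G.induce W).connectedComponentMk u = (G.induce W).connectedComponentMk v :=
        SimpleGraph.ConnectedComponent.sound (SimpleGraph.Adj.reachable huv)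
      simp only [root, this]
    let C := (G.induce W).connectedComponentMk v
    let K : Set V := Subtype.val '' C.supp
    have hconn : (G.induce K).Connected := by
      have h1 : ((G.induce W).induce C.supp).Connected := C.connected_toSimpleGraph
      refine h1.map (f := ⟨fun w => ⟨w.1.1, w.1, w.2, rfl⟩, fun h => h⟩) ?_
      rintro ⟨_, w, hw, rfl⟩
      exact ⟨⟨w, hw⟩, rfl⟩
    have hmem : ∀ w : W, (G.induce W).Reachable w v → (w : V) ∈ K := fun w hw =>
      ⟨w, SimpleGraph.ConnectedComponent.sound hw, rfl⟩
    have hne := hG.dist_ne_of_triangleFreeOn hconn (r := root v) (u := u) (v := v)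
      (fun a ha b hb c hc => hT a (by obtain ⟨a, -, rfl⟩ := ha; exact a.2) b
        (by obtain ⟨a, -, rfl⟩ := hb; exact a.2) c (by obtain ⟨a, -, rfl⟩ := hc; exact a.2))
      (hmem _ (hroot v)) (hmem _ (SimpleGraph.Adj.reachable huv))
      (hmem _ (SimpleGraph.Reachable.refl _)) huv
    have hreach : ∀ w : W, (G.induce W).Reachable (root v) w → G.Reachable (root v : V) w :=
      fun w hw => hw.map (SimpleGraph.Embedding.induce W).toHom
    obtain ⟨p, hp⟩ := (hreach v (hroot v)).exists_walk_length_eq_dist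
    obtain ⟨q, hq⟩ := (hreach u (hr ▸ hroot u)).exists_walk_length_eq_dist
    have h1 := SimpleGraph.dist_le (p.append (.cons huv.symm .nil))
    have h2 := SimpleGraph.dist_le (q.append (.cons huv .nil))
    simp only [SimpleGraph.Walk.length_append, SimpleGraph.Walk.length_cons,
      SimpleGraph.Walk.length_nil] at h1 h2
    simp only [f, hr]
    omega
  refine ⟨Subtype.val '' {v : W | f v % 2 = 0}, Subtype.val '' {v : W | ¬ f v % 2 = 0}, ?_, ?_,
    ?_, ?_⟩
  · rw [← Set.image_union]
    ext v
    constructor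
    · rintro ⟨v, -, rfl⟩; exact v.2
    · intro hv; exact ⟨⟨v, hv⟩, em (f ⟨v, hv⟩ % 2 = 0), rfl⟩
  · rw [Set.disjoint_image_iff Subtype.val_injective]
    exact disjoint_compl_right
  · rintro _ ⟨u, hu, rfl⟩ _ ⟨v, hv, rfl⟩ - huv
    exact key u v huv (by simp only [Set.mem_ofPred_eq] at hu hv; omega)
  · rintro _ ⟨u, hu, rfl⟩ _ ⟨v, hv, rfl⟩ - huv
    exact key u v huv (by simp only [Set.mem_ofPred_eq] at hu hv; omega)

/-! ### Necessity: the four graphs have no clique meeting all triangles -/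

lemma IsInducedFree.isEmpty_embedding {V W : Type*} {H : SimpleGraph W} {G : SimpleGraph V}
    (h : IsInducedFree H G) : IsEmpty (H ↪g G) := by
  refine ⟨fun f => (h (Set.range f)).false ?_⟩
  exact ⟨Equiv.ofInjective f f.injective, by simp⟩

/-- Two stable sets cannot cover a triangle, so the clique part of the partition, pulled back to
`H`, meets every triangle of `H`. -/
lemma IsTwoOneGraph.exists_transversal {V W : Type*} {H : SimpleGraph W} {G : SimpleGraph V}
    (h : IsTwoOneGraph G) {S : Set V} (f : H ≃g G.induce S) :
    ∃ Q : W → Prop, (∀ a b, a ≠ b → Q a → Q b → H.Adj a b) ∧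
      ∀ a b c, H.Adj a b → H.Adj a c → H.Adj b c → Q a ∨ Q b ∨ Q c := by
  obtain ⟨A, B, Q, hU, -, -, -, hA, hB, hQ⟩ := h
  have hadj : ∀ a b, H.Adj a b ↔ G.Adj (f a : V) (f b) := fun a b => f.map_adj_iff.symm
  have hinj : ∀ a b, a ≠ b → (f a : V) ≠ f b := fun a b hab h =>
    hab (f.injective (Subtype.ext h))
  refine ⟨fun w => (f w : V) ∈ Q, fun a b hab ha hb => (hadj a b).2 (hQ ha hb (hinj a b hab)), ?_⟩
  intro a b c hab hac hbc
  by_contra! hcon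
  have hAB : ∀ w, (f w : V) ∉ Q → (f w : V) ∈ A ∨ (f w : V) ∈ B := by
    intro w hw
    have : (f w : V) ∈ A ∪ B ∪ Q := hU ▸ Set.mem_univ _
    rcases this with h | h
    · exact h
    · exact absurd h hw
  have nA : ∀ a b, H.Adj a b → (f a : V) ∈ A → (f b : V) ∉ A := fun a b h ha hb =>
    hA ha hb (hinj a b h.ne) ((hadj a b).1 h)
  have nB : ∀ a b, H.Adj a b → (f a : V) ∈ B → (f b : V) ∉ B := fun a b h ha hb =>
    hB ha hb (hinj a b h.ne) ((hadj a b).1 h)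
  have := hAB a hcon.1
  have := hAB b hcon.2.1
  have := hAB c hcon.2.2
  have := nA a b hab
  have := nA a c hac
  have := nA b c hbc
  have := nB a b hab
  have := nB a c hac
  have := nB b c hbc
  tauto

lemma IsTwoOneGraph.free_graphG1 {V : Type*} {G : SimpleGraph V} (h : IsTwoOneGraph G) :
    IsInducedFree graphG1 G := by
  refine fun S => ⟨fun f => ?_⟩
  obtain ⟨Q, hQ, hT⟩ := h.exists_transversal f
  have t1 := hT 0 1 2 (by simp [graphG1]) (by simp [graphG1]) (by simp [graphG1])
  have t2 := hT 3 4 5 (by simp [graphG1]) (by simp [graphG1]) (by simp [graphG1])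
  rcases t1 with a | a | a <;> rcases t2 with b | b | b <;>
    simpa [graphG1] using hQ _ _ (by decide) a b

lemma IsTwoOneGraph.free_graphG5 {V : Type*} {G : SimpleGraph V} (h : IsTwoOneGraph G) :
    IsInducedFree graphG5 G := by
  refine fun S => ⟨fun f => ?_⟩
  obtain ⟨Q, hQ, hT⟩ := h.exists_transversal f
  have t1 := hT 0 2 3 (by simp [graphG5]) (by simp [graphG5]) (by simp [graphG5])
  have t2 := hT 0 4 5 (by simp [graphG5]) (by simp [graphG5]) (by simp [graphG5])
  have t3 := hT 1 2 3 (by simp [graphG5]) (by simp [graphG5]) (by simp [graphG5])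
  have t4 := hT 1 4 5 (by simp [graphG5]) (by simp [graphG5]) (by simp [graphG5])
  have n01 := hQ 0 1 (by decide)
  have n24 := hQ 2 4 (by decide)
  have n25 := hQ 2 5 (by decide)
  have n34 := hQ 3 4 (by decide)
  have n35 := hQ 3 5 (by decide)
  simp [graphG5] at n01 n24 n25 n34 n35
  tauto

lemma IsTwoOneGraph.free_graphG6 {V : Type*} {G : SimpleGraph V} (h : IsTwoOneGraph G) :
    IsInducedFree graphG6 G := by
  refine fun S => ⟨fun f => ?_⟩
  obtain ⟨Q, hQ, hT⟩ := h.exists_transversal f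
  have t1 := hT 0 2 3 (by simp [graphG6]) (by simp [graphG6]) (by simp [graphG6])
  have t2 := hT 0 3 4 (by simp [graphG6]) (by simp [graphG6]) (by simp [graphG6])
  have t3 := hT 0 4 5 (by simp [graphG6]) (by simp [graphG6]) (by simp [graphG6])
  have t4 := hT 0 2 5 (by simp [graphG6]) (by simp [graphG6]) (by simp [graphG6])
  have t5 := hT 1 2 3 (by simp [graphG6]) (by simp [graphG6]) (by simp [graphG6])
  have t6 := hT 1 3 4 (by simp [graphG6]) (by simp [graphG6]) (by simp [graphG6])
  have t7 := hT 1 4 5 (by simp [graphG6]) (by simp [graphG6]) (by simp [graphG6])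
  have t8 := hT 1 2 5 (by simp [graphG6]) (by simp [graphG6]) (by simp [graphG6])
  have n01 := hQ 0 1 (by decide)
  have n24 := hQ 2 4 (by decide)
  have n35 := hQ 3 5 (by decide)
  simp [graphG6] at n01 n24 n35
  grind

lemma IsTwoOneGraph.free_graphG7 {V : Type*} {G : SimpleGraph V} (h : IsTwoOneGraph G) :
    IsInducedFree graphG7 G := by
  refine fun S => ⟨fun f => ?_⟩
  obtain ⟨Q, hQ, hT⟩ := h.exists_transversal f
  have t1 := hT 0 1 2 (by simp [graphG7]) (by simp [graphG7]) (by simp [graphG7])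
  have t2 := hT 0 1 3 (by simp [graphG7]) (by simp [graphG7]) (by simp [graphG7])
  have t3 := hT 4 5 6 (by simp [graphG7]) (by simp [graphG7]) (by simp [graphG7])
  have n04 := hQ 0 4 (by decide)
  have n05 := hQ 0 5 (by decide)
  have n06 := hQ 0 6 (by decide)
  have n14 := hQ 1 4 (by decide)
  have n15 := hQ 1 5 (by decide)
  have n16 := hQ 1 6 (by decide)
  have n23 := hQ 2 3 (by decide)
  have n25 := hQ 2 5 (by decide)
  have n26 := hQ 2 6 (by decide)
  simp [graphG7] at n04 n05 n06 n14 n15 n16 n23 n25 n26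
  grind

/-! ### The forbidden subgraphs as vertex configurations -/

/-- The four forbidden induced subgraphs are absent, in terms of vertices. -/
structure ForbidsObstructions {V : Type*} (G : SimpleGraph V) : Prop where
  two_triangles : ∀ {a b c d e f : V}, G.Adj a b → G.Adj a c → G.Adj b c → G.Adj d e → G.Adj d f →
    G.Adj e f → (∀ u ∈ ({a, b, c} : Set V), ∀ v ∈ ({d, e, f} : Set V), ¬ G.Adj u v) → False
  two_edges : ∀ {a b p q r s : V}, a ≠ b → ¬ G.Adj a b → G.Adj p q → G.Adj r s →
    ¬ G.Adj p r → ¬ G.Adj p s → ¬ G.Adj q r → ¬ G.Adj q s →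
    (∀ u ∈ ({a, b} : Set V), ∀ v ∈ ({p, q, r, s} : Set V), G.Adj u v) → False
  four_cycle : ∀ {a b p q r s : V}, a ≠ b → ¬ G.Adj a b → p ≠ r → q ≠ s → ¬ G.Adj p r →
    ¬ G.Adj q s → G.Adj p q → G.Adj q r → G.Adj r s → G.Adj p s →
    (∀ u ∈ ({a, b} : Set V), ∀ v ∈ ({p, q, r, s} : Set V), G.Adj u v) → False
  diamond_triangle : ∀ {x y a b u r s : V}, a ≠ b → ¬ G.Adj a b → G.Adj x y → G.Adj x a →
    G.Adj y a → G.Adj x b → G.Adj y b → G.Adj a u → G.Adj b u → G.Adj u r → G.Adj u s →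
    G.Adj r s → ¬ G.Adj x u → ¬ G.Adj y u →
    (∀ v ∈ ({x, y, a, b} : Set V), ∀ w ∈ ({r, s} : Set V), ¬ G.Adj v w) → False

lemma forbidsObstructions_of_isInducedFree {V : Type*} {G : SimpleGraph V}
    (h1 : IsInducedFree graphG1 G) (h5 : IsInducedFree graphG5 G)
    (h6 : IsInducedFree graphG6 G) (h7 : IsInducedFree graphG7 G) : ForbidsObstructions G where
  two_triangles := by
    intro a b c d e f hab hac hbc hde hdf hef hn
    simp only [Set.mem_insert_iff, Set.mem_singleton_iff, forall_eq_or_imp, forall_eq] at hn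
    obtain ⟨⟨h11, h12, h13⟩, ⟨h21, h22, h23⟩, h31, h32, h33⟩ := hn
    refine h1.isEmpty_embedding.false
      (⟨⟨![a, b, c, d, e, f], ?_⟩, ?_⟩ : graphG1 ↪g G)
    · simp only [Function.Injective, Fin.forall_fin_succ]
      simp
      grind (splits := 60) [SimpleGraph.Adj.symm, SimpleGraph.irrefl]
    · simp only [Fin.forall_fin_succ, graphG1]
      simp
      grind [SimpleGraph.adj_comm]
  two_edges := by
    intro a b p q r s hne hab hpq hrs n1 n2 n3 n4 hn
    simp only [Set.mem_insert_iff, Set.mem_singleton_iff, forall_eq_or_imp, forall_eq] at hn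
    obtain ⟨⟨h11, h12, h13, h14⟩, h21, h22, h23, h24⟩ := hn
    refine h5.isEmpty_embedding.false
      (⟨⟨![a, b, p, q, r, s], ?_⟩, ?_⟩ : graphG5 ↪g G)
    · simp only [Function.Injective, Fin.forall_fin_succ]
      simp
      grind (splits := 60) [SimpleGraph.Adj.symm, SimpleGraph.irrefl]
    · simp only [Fin.forall_fin_succ, graphG5]
      simp
      grind [SimpleGraph.adj_comm]
  four_cycle := by
    intro a b p q r s hne hab hpr hqs n1 n2 e1 e2 e3 e4 hn
    simp only [Set.mem_insert_iff, Set.mem_singleton_iff, forall_eq_or_imp, forall_eq] at hn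
    obtain ⟨⟨h11, h12, h13, h14⟩, h21, h22, h23, h24⟩ := hn
    refine h6.isEmpty_embedding.false
      (⟨⟨![a, b, p, q, r, s], ?_⟩, ?_⟩ : graphG6 ↪g G)
    · simp only [Function.Injective, Fin.forall_fin_succ]
      simp
      grind (splits := 60) [SimpleGraph.Adj.symm, SimpleGraph.irrefl]
    · simp only [Fin.forall_fin_succ, graphG6]
      simp
      grind [SimpleGraph.adj_comm]
  diamond_triangle := by
    intro x y a b u r s hne hab hxy hxa hya hxb hyb hau hbu hur hus hrs hxu hyu hn
    simp only [Set.mem_insert_iff, Set.mem_singleton_iff, forall_eq_or_imp, forall_eq] at hn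
    obtain ⟨⟨h11, h12⟩, ⟨h21, h22⟩, ⟨h31, h32⟩, h41, h42⟩ := hn
    refine h7.isEmpty_embedding.false
      (⟨⟨![x, y, a, b, u, r, s], ?_⟩, ?_⟩ : graphG7 ↪g G)
    · simp only [Function.Injective, Fin.forall_fin_succ]
      simp
      grind (splits := 60) [SimpleGraph.Adj.symm, SimpleGraph.irrefl]
    · simp only [Fin.forall_fin_succ, graphG7]
      simp
      grind [SimpleGraph.adj_comm]

/-! ### Transversal cliques and threshold sets -/

/-- Some clique inside `W` meets all triangles inside `W`. -/
def HasTransversal {V : Type*} (G : SimpleGraph V) (W : Set V) : Prop :=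
  ∃ Q ⊆ W, G.IsClique Q ∧ ∀ a ∈ W, ∀ b ∈ W, ∀ c ∈ W, G.Adj a b → G.Adj a c → G.Adj b c →
    a ∈ Q ∨ b ∈ Q ∨ c ∈ Q

/-- `P` has no alternating four-cycle, i.e. it induces a threshold graph. -/
def IsThresholdOn {V : Type*} (G : SimpleGraph V) (P : Set V) : Prop :=
  ∀ p ∈ P, ∀ q ∈ P, ∀ k ∈ P, ∀ l ∈ P, G.Adj p q → G.Adj k l → p ≠ k → ¬ G.Adj p k → q ≠ l →
    ¬ G.Adj q l → False

/-- An alternating four-cycle induces `C₄`, `2K₂` or `P₄`. Joined to `c` and `d`, the first two give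
$G_6$ and $G_5$; the ends of a `P₄` cannot have the common neighbour `c`. -/
lemma ForbidsObstructions.isThresholdOn {V : Type*} {G : SimpleGraph V}
    (hF : ForbidsObstructions G) (hA : HasUniformAttachment G) {P : Set V} {c d : V} (hcd : c ≠ d)
    (hn : ¬ G.Adj c d) (hc : ∀ p ∈ P, G.Adj c p) (hd : ∀ p ∈ P, G.Adj d p) :
    IsThresholdOn G P := by
  intro p hp q hq k hk l hl hpq hkl hpk npk hql nql
  by_cases hpl : G.Adj p l
  · by_cases hqk : G.Adj q k
    · refine hF.four_cycle hcd hn hpk hql npk nql hpq hqk hkl hpl ?_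
      rintro u (rfl | rfl) v (rfl | rfl | rfl | rfl) <;> solve_by_elim
    · exact hA.path_four hpq.symm hpl hkl.symm nql hqk npk (hc q hq) (hc k hk)
  · by_cases hqk : G.Adj q k
    · exact hA.path_four hpq hqk hkl npk hpl nql (hc p hp) (hc l hl)
    · refine hF.two_edges hcd hn hpq hkl npk hpl hqk nql ?_
      rintro u (rfl | rfl) v (rfl | rfl | rfl | rfl) <;> solve_by_elim

/-- Threshold graphs are split. Take a largest clique `K` containing `U`. For an edge `pq` outside
`K`, the threshold condition forces `p` and `q` to miss one and the same vertex `k` of `K`. As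
vertices of `U` dominate all edges, `k` is not in `U`, and replacing `k` by `p` and `q` gives a
larger clique. -/
lemma IsThresholdOn.exists_isClique {V : Type*} [Finite V] {G : SimpleGraph V} {P U : Set V}
    (hP : IsThresholdOn G P) (hUP : U ⊆ P) (hU : G.IsClique U)
    (hUe : ∀ u ∈ U, ∀ p ∈ P, ∀ q ∈ P, G.Adj p q → u = p ∨ u = q ∨ G.Adj u p ∨ G.Adj u q) :
    ∃ K, U ⊆ K ∧ K ⊆ P ∧ G.IsClique K ∧ ∀ p ∈ P \ K, ∀ q ∈ P \ K, ¬ G.Adj p q := by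
  obtain ⟨K, ⟨hUK, hKP, hK⟩, hmax⟩ := Set.exists_max_image
    {K : Set V | U ⊆ K ∧ K ⊆ P ∧ G.IsClique K} Set.ncard (Set.toFinite _)
    ⟨U, subset_rfl, hUP, hU⟩
  refine ⟨K, hUK, hKP, hK, ?_⟩
  have hext : ∀ p ∈ P \ K, ∃ k ∈ K, ¬ G.Adj p k := by
    intro p hp
    by_contra! hcon
    have h1 := hmax (insert p K) ⟨hUK.trans (Set.subset_insert _ _),
      Set.insert_subset hp.1 hKP, hK.insert fun b hb _ => hcon b hb⟩
    rw [Set.ncard_insert_of_notMem hp.2] at h1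
    omega
  have hne : ∀ p ∈ P \ K, ∀ k ∈ K, p ≠ k := by
    rintro p hp k hk rfl
    exact hp.2 hk
  have hsame : ∀ p ∈ P \ K, ∀ q ∈ P \ K, G.Adj p q → ∀ k ∈ K, ∀ l ∈ K, ¬ G.Adj p k →
      ¬ G.Adj q l → k = l := by
    intro p hp q hq hpq k hk l hl hpk hql
    by_contra hkl
    exact hP p hp.1 q hq.1 k (hKP hk) l (hKP hl) hpq (hK hk hl hkl) (hne p hp k hk) hpk
      (hne q hq l hl) hql
  intro p hp q hq hpq
  obtain ⟨k, hk, hpk⟩ := hext p hp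
  obtain ⟨l, hl, hql⟩ := hext q hq
  obtain rfl := hsame p hp q hq hpq k hk l hl hpk hql
  have hkU : k ∉ U := by
    intro hkU
    rcases hUe k hkU p hp.1 q hq.1 hpq with h | h | h | h
    · exact hne p hp k hk h.symm
    · exact hne q hq k hk h.symm
    · exact hpk h.symm
    · exact hql h.symm
  have hp' : ∀ l ∈ K \ {k}, G.Adj p l := fun l hl => by
    by_contra h
    exact hl.2 (hsame p hp q hq hpq l hl.1 k hk h hql)
  have hq' : ∀ l ∈ K \ {k}, G.Adj q l := fun l hl => by
    by_contra h
    exact hl.2 (hsame p hp q hq hpq k hk l hl.1 hpk h).symm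
  have h1 := hmax (insert p (insert q (K \ {k}))) ⟨?_, ?_, ?_⟩
  · rw [Set.ncard_insert_of_notMem, Set.ncard_insert_of_notMem,
      Set.ncard_sdiff_singleton_of_mem hk] at h1
    · have : 0 < K.ncard := (Set.ncard_pos (Set.toFinite K)).2 ⟨k, hk⟩
      omega
    · exact fun h => hq.2 h.1
    · rintro (h | h)
      · exact hpq.ne h
      · exact hp.2 h.1
  · intro u hu
    exact Or.inr (Or.inr ⟨hUK hu, by rintro rfl; exact hkU hu⟩)
  · exact Set.insert_subset hp.1 (Set.insert_subset hq.1 (Set.sdiff_subset.trans hKP))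
  · refine ((hK.subset Set.sdiff_subset).insert fun b hb _ => hq' b hb).insert ?_
    rintro b (rfl | hb) -
    · exact hpq
    · exact hp' b hb

/-! ### Decomposition of `P₄`-free sets -/

/-- `D` splits into nonempty anticomplete sets `A`, `B` and a further set `Z`. -/
structure IsCutPartition {V : Type*} (G : SimpleGraph V) (D A B Z : Set V) : Prop where
  union : A ∪ B ∪ Z = D
  disj : ∀ z ∈ Z, z ∉ A ∪ B
  anti : ∀ a ∈ A, ∀ b ∈ B, a ≠ b ∧ ¬ G.Adj a b
  left : A.Nonempty
  right : B.Nonempty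

lemma IsCutPartition.symm {V : Type*} {G : SimpleGraph V} {D A B Z : Set V}
    (h : IsCutPartition G D A B Z) : IsCutPartition G D B A Z :=
  ⟨by rw [Set.union_comm B A, h.union], by rw [Set.union_comm B A]; exact h.disj,
    fun b hb a ha => ⟨(h.anti a ha b hb).1.symm, fun hab => (h.anti a ha b hb).2 hab.symm⟩,
    h.right, h.left⟩

/-- No induced path on four vertices inside `D`. -/
def IsPathFourFreeOn {V : Type*} (G : SimpleGraph V) (D : Set V) : Prop :=
  ∀ p ∈ D, ∀ q ∈ D, ∀ r ∈ D, ∀ s ∈ D, G.Adj p q → G.Adj q r → G.Adj r s → ¬ G.Adj p r →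
    ¬ G.Adj p s → ¬ G.Adj q s → False

/-- By minimality `z` has a neighbour `b` in `B`, as otherwise `z` could move to `A`. An edge from a
non-neighbour to a neighbour of `z` inside `A` would start an induced `P₄` ending in `z`, `b`.
Hence, if `z` misses some vertex of `A`, then `z` and its neighbours in `A` can move to `B`,
shrinking `Z`. -/
lemma IsCutPartition.adj_of_minimal {V : Type*} {G : SimpleGraph V} {D A B Z : Set V}
    (hD : IsPathFourFreeOn G D) (h : IsCutPartition G D A B Z)
    (hmin : ∀ A' B' Z', IsCutPartition G D A' B' Z' → ¬ Z' ⊂ Z) {z a : V} (hz : z ∈ Z)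
    (ha : a ∈ A) : G.Adj z a := by
  have hu := h.union
  have hlt : Z \ {z} ⊂ Z := ⟨Set.sdiff_subset, fun h => (h hz).2 rfl⟩
  have hmem : ∀ v, v ∈ A ∪ B ∪ Z → v ∈ D := fun v hv => hu ▸ hv
  have hzd := h.disj z hz
  have hb : ∃ b ∈ B, G.Adj z b := by
    by_contra! hcon
    refine hmin (insert z A) B (Z \ {z}) ⟨?_, ?_, ?_, ?_, h.right⟩ hlt
    · rw [← hu]; ext v; by_cases hv : v = z <;> simp [hv, hz]
    · rintro v ⟨hv, hvz⟩ ((rfl | hA) | hB)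
      · exact hvz rfl
      · exact h.disj v hv (Or.inl hA)
      · exact h.disj v hv (Or.inr hB)
    · rintro v (rfl | hv) b hb
      · exact ⟨by rintro rfl; exact hzd (Or.inr hb), hcon b hb⟩
      · exact h.anti v hv b hb
    · exact ⟨z, Set.mem_insert _ _⟩
  obtain ⟨b, hb, hzb⟩ := hb
  by_contra hza
  have hno : ∀ a' ∈ A, ∀ a'' ∈ A, ¬ G.Adj z a' → G.Adj z a'' → ¬ G.Adj a' a'' := by
    intro a' ha' a'' ha'' h1 h2 h3
    exact hD a' (hmem _ (.inl (.inl ha'))) a'' (hmem _ (.inl (.inl ha''))) z (hmem _ (.inr hz)) b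
      (hmem _ (.inl (.inr hb))) h3 h2.symm hzb (fun h => h1 h.symm) (h.anti a' ha' b hb).2
      (h.anti a'' ha'' b hb).2
  refine hmin {v ∈ A | ¬ G.Adj z v} (insert z (B ∪ {v ∈ A | G.Adj z v})) (Z \ {z})
    ⟨?_, ?_, ?_, ⟨a, ha, hza⟩, ⟨z, Set.mem_insert _ _⟩⟩ hlt
  · rw [← hu]; ext v
    by_cases hv : v = z
    · simp [hv, hz]
    · simp only [Set.mem_union, Set.mem_insert_iff, Set.mem_sdiff, Set.mem_singleton_iff, hv,
        Set.mem_sep_iff]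
      tauto
  · rintro v ⟨hv, hvz⟩ (hA | rfl | hB | hA)
    · exact h.disj v hv (Or.inl hA.1)
    · exact hvz rfl
    · exact h.disj v hv (Or.inr hB)
    · exact h.disj v hv (Or.inl hA.1)
  · rintro v ⟨hv, hzv⟩ w (rfl | hw | ⟨hw, hzw⟩)
    · exact ⟨by rintro rfl; exact hzd (Or.inl hv), fun h => hzv h.symm⟩
    · exact h.anti v hv w hw
    · exact ⟨by rintro rfl; exact hzv hzw, hno v hv w hw hzv hzw⟩

/-- A `P₄`-free set that is not a clique has a cut partition whose third part is complete to the
other two. -/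
lemma IsPathFourFreeOn.exists_isCutPartition {V : Type*} [Finite V] {G : SimpleGraph V} {D : Set V}
    (hD : IsPathFourFreeOn G D) (hn : ¬ G.IsClique D) :
    ∃ A B Z, IsCutPartition G D A B Z ∧ ∀ z ∈ Z, ∀ v ∈ A ∪ B, G.Adj z v := by
  have hex : {Z : Set V | ∃ A B, IsCutPartition G D A B Z}.Nonempty := by
    simp only [SimpleGraph.IsClique, Set.Pairwise] at hn
    push Not at hn
    obtain ⟨a, ha, b, hb, hab, nab⟩ := hn
    refine ⟨D \ {a, b}, {a}, {b}, ?_, ?_, ?_, ⟨a, rfl⟩, ⟨b, rfl⟩⟩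
    · ext v
      by_cases h1 : v = a
      · simp [h1, ha]
      · by_cases h2 : v = b <;> simp [h1, h2, hb]
    · rintro z ⟨-, hz⟩ (h | h)
      · exact hz (Or.inl h)
      · exact hz (Or.inr h)
    · rintro _ rfl _ rfl
      exact ⟨hab, nab⟩
  obtain ⟨Z, ⟨A, B, h⟩, hmin⟩ := (wellFounded_lt (α := Set V)).has_min _ hex
  have hmin' : ∀ A' B' Z', IsCutPartition G D A' B' Z' → ¬ Z' ⊂ Z := fun A' B' Z' h' =>
    hmin Z' ⟨A', B', h'⟩
  refine ⟨A, B, Z, h, ?_⟩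
  rintro z hz v (hv | hv)
  · exact h.adj_of_minimal hD hmin' hz hv
  · exact h.symm.adj_of_minimal hD hmin' hz hv

lemma triangleFreeOn_union_of_isIndep {V : Type*} {G : SimpleGraph V} {P R : Set V}
    (hP : ∀ p ∈ P, ∀ q ∈ P, ¬ G.Adj p q) (hR : ∀ p ∈ R, ∀ q ∈ R, ¬ G.Adj p q) :
    TriangleFreeOn G (P ∪ R) := by
  rintro a (ha | ha) b (hb | hb) c (hc | hc) hab hac hbc
  all_goals
    first
    | exact hP a ha b hb hab
    | exact hP a ha c hc hac
    | exact hP b hb c hc hbc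
    | exact hR a ha b hb hab
    | exact hR a ha c hc hac
    | exact hR b hb c hc hbc

lemma SimpleGraph.IsClique.union_of_complete {V : Type*} {G : SimpleGraph V} {P R : Set V}
    (hP : G.IsClique P) (hR : G.IsClique R) (h : ∀ p ∈ P, ∀ r ∈ R, G.Adj p r) :
    G.IsClique (P ∪ R) := by
  rintro a (ha | ha) b (hb | hb) hab
  · exact hP ha hb hab
  · exact h a ha b hb
  · exact (h b hb a ha).symm
  · exact hR ha hb hab

lemma exists_pair_of_not_isClique {V : Type*} {G : SimpleGraph V} {D : Set V}
    (hn : ¬ G.IsClique D) : ∃ a ∈ D, ∃ b ∈ D, a ≠ b ∧ ¬ G.Adj a b := by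
  simp only [SimpleGraph.IsClique, Set.Pairwise] at hn
  push Not at hn
  exact hn

lemma HasTransversal.of_universal {V : Type*} {G : SimpleGraph V} {W : Set V} {z : V}
    (hz : z ∈ W) (hu : ∀ w ∈ W, w ≠ z → G.Adj z w) (h : HasTransversal G (W \ {z})) :
    HasTransversal G W := by
  obtain ⟨Q, hQW, hQ, hT⟩ := h
  refine ⟨insert z Q, Set.insert_subset hz (hQW.trans Set.sdiff_subset),
    hQ.insert fun b hb hne => hu b (hQW hb).1 hne.symm, ?_⟩
  intro a ha b hb c hc hab hac hbc
  by_cases h1 : a = z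
  · exact .inl (.inl h1)
  by_cases h2 : b = z
  · exact .inr (.inl (.inl h2))
  by_cases h3 : c = z
  · exact .inr (.inr (.inl h3))
  rcases hT a ⟨ha, h1⟩ b ⟨hb, h2⟩ c ⟨hc, h3⟩ hab hac hbc with h | h | h
  · exact .inl (.inr h)
  · exact .inr (.inl (.inr h))
  · exact .inr (.inr (.inr h))

lemma HasTransversal.of_anticomplete {V : Type*} {G : SimpleGraph V} {A B : Set V}
    (hA : TriangleFreeOn G A) (hAB : ∀ a ∈ A, ∀ b ∈ B, ¬ G.Adj a b) (h : HasTransversal G B) :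
    HasTransversal G (A ∪ B) := by
  obtain ⟨Q, hQB, hQ, hT⟩ := h
  refine ⟨Q, hQB.trans Set.subset_union_right, hQ, ?_⟩
  rintro a (ha | ha) b (hb | hb) c (hc | hc) hab hac hbc
  · exact (hA a ha b hb c hc hab hac hbc).elim
  · exact (hAB _ ha _ hc hac).elim
  · exact (hAB _ ha _ hb hab).elim
  · exact (hAB _ ha _ hb hab).elim
  · exact (hAB _ hb _ ha hab.symm).elim
  · exact (hAB _ hb _ ha hab.symm).elim
  · exact (hAB _ hc _ ha hac.symm).elim
  · exact hT a ha b hb c hc hab hac hbc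

/-- A `P₄`-free set all of whose proper subsets have a transversal has one. -/
lemma ForbidsObstructions.hasTransversal_of_isPathFourFreeOn {V : Type*} [Finite V]
    {G : SimpleGraph V} (hF : ForbidsObstructions G) (hA : HasUniformAttachment G) {W : Set V}
    (hW : IsPathFourFreeOn G W) (hmin : ∀ W' ⊂ W, HasTransversal G W') : HasTransversal G W := by
  by_cases hcl : G.IsClique W
  · exact ⟨W, subset_rfl, hcl, fun a ha _ _ _ _ _ _ _ => .inl ha⟩
  obtain ⟨A, B, Z, h, hZ⟩ := hW.exists_isCutPartition hcl
  obtain ⟨a, ha⟩ := h.left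
  obtain ⟨b, hb⟩ := h.right
  have hsub : ∀ v, v ∈ A ∪ B ∪ Z → v ∈ W := fun v hv => h.union ▸ hv
  rcases Z.eq_empty_or_nonempty with rfl | ⟨z, hz⟩
  · have hu : A ∪ B = W := by simpa using h.union
    by_cases hTA : TriangleFreeOn G A
    · rw [← hu]
      refine .of_anticomplete hTA (fun a ha b hb => (h.anti a ha b hb).2) (hmin B ⟨?_, ?_⟩)
      · rw [← hu]; exact Set.subset_union_right
      · exact fun hs => (h.anti a ha a (hs (hu ▸ .inl ha))).1 rfl
    · by_cases hTB : TriangleFreeOn G B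
      · rw [← hu, Set.union_comm]
        refine .of_anticomplete hTB (fun b hb a ha => (h.symm.anti b hb a ha).2) (hmin A ⟨?_, ?_⟩)
        · rw [← hu]; exact Set.subset_union_left
        · exact fun hs => (h.anti b (hs (hu ▸ .inr hb)) b hb).1 rfl
      · simp only [TriangleFreeOn] at hTA hTB
        push Not at hTA hTB
        obtain ⟨p, hp, q, hq, r, hr, hpq, hpr, hqr, -⟩ := hTA
        obtain ⟨p', hp', q', hq', r', hr', hpq', hpr', hqr', -⟩ := hTB
        refine (hF.two_triangles hpq hpr hqr hpq' hpr' hqr' ?_).elim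
        rintro u (rfl | rfl | rfl) v (rfl | rfl | rfl) <;> exact (h.anti _ ‹_› _ ‹_›).2
  · by_cases huniv : ∀ w ∈ W, w ≠ z → G.Adj z w
    · exact .of_universal (hsub z (.inr hz)) huniv
        (hmin _ ⟨Set.sdiff_subset, fun hs => (hs (hsub z (.inr hz))).2 rfl⟩)
    push Not at huniv
    obtain ⟨w, hw, hwz, nzw⟩ := huniv
    have hwZ : w ∈ Z := by
      rw [← h.union] at hw
      rcases hw with hw | hw
      · exact absurd (hZ z hz w hw) nzw
      · exact hw
    obtain ⟨nab, hab⟩ := h.anti a ha b hb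
    obtain ⟨K, -, hKZ, hK, hKi⟩ := (hF.isThresholdOn hA nab hab
      (fun p hp => (hZ p hp a (.inl ha)).symm) (fun p hp => (hZ p hp b (.inr hb)).symm) :
      IsThresholdOn G Z).exists_isClique (Set.empty_subset _) (by simp) (by simp)
    obtain ⟨L, -, hLZ, hL, hLi⟩ := (hF.isThresholdOn hA hwz.symm nzw
      (fun p hp => hZ z hz p hp) (fun p hp => hZ w hwZ p hp) :
      IsThresholdOn G (A ∪ B)).exists_isClique (Set.empty_subset _) (by simp) (by simp)
    -- Each factor of the join contains a non-adjacent pair, so the other factor is threshold, with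
    -- clique `K` or `L` and a stable remainder. The two stable remainders together contain no
    -- triangle.
    refine ⟨K ∪ L, ?_, hK.union_of_complete hL fun p hp q hq => hZ p (hKZ hp) q (hLZ hq), ?_⟩
    · rintro v (hv | hv)
      · exact hsub v (.inr (hKZ hv))
      · exact hsub v (.inl (hLZ hv))
    · intro p hp q hq r hr hpq hpr hqr
      by_contra! hcon
      have hmem : ∀ v ∈ W, v ∉ K ∪ L → v ∈ Z \ K ∪ (A ∪ B) \ L := by
        intro v hv hn
        rw [← h.union] at hv
        rcases hv with hv | hv
        · exact .inr ⟨hv, fun h => hn (.inr h)⟩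
        · exact .inl ⟨hv, fun h => hn (.inl h)⟩
      exact triangleFreeOn_union_of_isIndep hKi hLi p (hmem p hp hcon.1) q (hmem q hq hcon.2.1) r
        (hmem r hr hcon.2.2) hpq hpr hqr

/-! ### Split obstructions: one of the attachment sets is a clique -/

/-- A set without transversal, all of whose proper subsets have one and all of whose vertices lie
in triangles, divided into two sides `X ∪ S` and `D ∪ E` that both contain triangles and between
which exactly the pairs in `S × D` are adjacent. -/
structure IsSplitObstruction {V : Type*} (G : SimpleGraph V) (X S D E : Set V) : Prop where
  disj : ∀ v ∈ X ∪ S, v ∉ D ∪ E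
  sd : ∀ s ∈ S, ∀ d ∈ D, G.Adj s d
  xd : ∀ x ∈ X, ∀ v ∈ D ∪ E, ¬ G.Adj x v
  se : ∀ e ∈ E, ∀ v ∈ X ∪ S, ¬ G.Adj e v
  triangle_left : ¬ TriangleFreeOn G (X ∪ S)
  triangle_right : ¬ TriangleFreeOn G (D ∪ E)
  every : ∀ v ∈ X ∪ S ∪ (D ∪ E), ∃ a ∈ X ∪ S ∪ (D ∪ E), ∃ b ∈ X ∪ S ∪ (D ∪ E),
    G.Adj v a ∧ G.Adj v b ∧ G.Adj a b
  not_hasTransversal : ¬ HasTransversal G (X ∪ S ∪ (D ∪ E))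
  minimal : ∀ W ⊂ X ∪ S ∪ (D ∪ E), HasTransversal G W

lemma exists_triangle_of_not_triangleFreeOn {V : Type*} {G : SimpleGraph V} {W : Set V}
    (h : ¬ TriangleFreeOn G W) :
    ∃ a ∈ W, ∃ b ∈ W, ∃ c ∈ W, G.Adj a b ∧ G.Adj a c ∧ G.Adj b c := by
  simp only [TriangleFreeOn] at h
  push Not at h
  obtain ⟨a, ha, b, hb, c, hc, h1, h2, h3, -⟩ := h
  exact ⟨a, ha, b, hb, c, hc, h1, h2, h3⟩

/-- The vertices of `S` that form a triangle with an edge inside `X`. -/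
def edgeAttachment {V : Type*} (G : SimpleGraph V) (X S : Set V) : Set V :=
  {s ∈ S | ∃ x ∈ X, ∃ y ∈ X, G.Adj x y ∧ G.Adj x s ∧ G.Adj y s}

namespace IsSplitObstruction

variable {V : Type*} {G : SimpleGraph V} {X S D E : Set V}

lemma symm (h : IsSplitObstruction G X S D E) : IsSplitObstruction G E D S X := by
  have hu : E ∪ D ∪ (S ∪ X) = X ∪ S ∪ (D ∪ E) := by
    ext v; simp only [Set.mem_union]; tauto
  refine ⟨?_, fun d hd s hs => (h.sd s hs d hd).symm, ?_, ?_, ?_, ?_, ?_, ?_, ?_⟩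
  · intro v hv hv'
    exact h.disj v hv'.symm hv.symm
  · intro e he v hv
    exact h.se e he v hv.symm
  · intro x hx v hv
    exact h.xd x hx v hv.symm
  · rw [Set.union_comm]; exact h.triangle_right
  · rw [Set.union_comm]; exact h.triangle_left
  · rw [hu]; exact h.every
  · rw [hu]; exact h.not_hasTransversal
  · rw [hu]; exact h.minimal

lemma triangleFreeOn (h : IsSplitObstruction G X S D E) (hF : ForbidsObstructions G) :
    TriangleFreeOn G X := by
  intro a ha b hb c hc hab hac hbc
  obtain ⟨d, hd, e, he, f, hf, hde, hdf, hef⟩ :=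
    exists_triangle_of_not_triangleFreeOn h.triangle_right
  refine hF.two_triangles hab hac hbc hde hdf hef ?_
  rintro u (rfl | rfl | rfl) v (rfl | rfl | rfl) <;> exact h.xd _ ‹_› _ ‹_›

lemma meets (h : IsSplitObstruction G X S D E) (hF : ForbidsObstructions G) {a b c : V}
    (ha : a ∈ X ∪ S) (hb : b ∈ X ∪ S) (hc : c ∈ X ∪ S) (hab : G.Adj a b) (hac : G.Adj a c)
    (hbc : G.Adj b c) : a ∈ S ∨ b ∈ S ∨ c ∈ S := by
  by_contra! hcon
  exact h.triangleFreeOn hF a (ha.resolve_right hcon.1) b (hb.resolve_right hcon.2.1) c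
    (hc.resolve_right hcon.2.2) hab hac hbc

lemma nonempty (h : IsSplitObstruction G X S D E) (hF : ForbidsObstructions G) : S.Nonempty := by
  obtain ⟨a, ha, b, hb, c, hc, hab, hac, hbc⟩ :=
    exists_triangle_of_not_triangleFreeOn h.triangle_left
  rcases h.meets hF ha hb hc hab hac hbc with h | h | h
  exacts [⟨a, h⟩, ⟨b, h⟩, ⟨c, h⟩]

/-- The side `X ∪ S` has a triangle of one of two shapes. -/
lemma triangle_shape (h : IsSplitObstruction G X S D E) (hF : ForbidsObstructions G) :
    (∃ s ∈ S, ∃ t ∈ S, G.Adj s t) ∨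
      ∃ s ∈ S, ∃ x ∈ X, ∃ y ∈ X, G.Adj s x ∧ G.Adj s y ∧ G.Adj x y := by
  obtain ⟨a, ha, b, hb, c, hc, hab, hac, hbc⟩ :=
    exists_triangle_of_not_triangleFreeOn h.triangle_left
  have hm := h.meets hF ha hb hc hab hac hbc
  by_cases h1 : a ∈ S <;> by_cases h2 : b ∈ S <;> by_cases h3 : c ∈ S
  · exact .inl ⟨a, h1, b, h2, hab⟩
  · exact .inl ⟨a, h1, b, h2, hab⟩
  · exact .inl ⟨a, h1, c, h3, hac⟩
  · exact .inr ⟨a, h1, b, hb.resolve_right h2, c, hc.resolve_right h3, hab, hac, hbc⟩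
  · exact .inl ⟨b, h2, c, h3, hbc⟩
  · exact .inr ⟨b, h2, a, ha.resolve_right h1, c, hc.resolve_right h3, hab.symm, hbc, hac⟩
  · exact .inr ⟨c, h3, a, ha.resolve_right h1, b, hb.resolve_right h2, hac.symm, hbc.symm, hab⟩
  · tauto

lemma notMem_of_mem_left (h : IsSplitObstruction G X S D E) (hF : ForbidsObstructions G) {x : V}
    (hx : x ∈ X) : x ∉ S := by
  intro hs
  obtain ⟨d, hd⟩ := h.symm.nonempty hF
  exact h.xd x hx d (.inl hd) (h.sd x hs d hd)

lemma mem_of_adj (h : IsSplitObstruction G X S D E) {x v : V} (hx : x ∈ X)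
    (hv : v ∈ X ∪ S ∪ (D ∪ E)) (hxv : G.Adj x v) : v ∈ X ∪ S :=
  hv.resolve_right fun hv => h.xd x hx v hv hxv

lemma exists_adj (h : IsSplitObstruction G X S D E) (hF : ForbidsObstructions G) {x : V}
    (hx : x ∈ X) : ∃ s ∈ S, G.Adj x s := by
  obtain ⟨a, ha, b, hb, h1, h2, h3⟩ := h.every x (.inl (.inl hx))
  rcases h.meets hF (.inl hx) (h.mem_of_adj hx ha h1) (h.mem_of_adj hx hb h2) h1 h2 h3
    with h' | h' | h'
  · exact absurd h' (h.notMem_of_mem_left hF hx)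
  · exact ⟨a, h', h1⟩
  · exact ⟨b, h', h2⟩

/-- Seen from a vertex `d` of `D`, the edge `xy` must attach uniformly to the neighbours of `d`;
both ends have a neighbour in `S`. -/
lemma adj_of_adj (h : IsSplitObstruction G X S D E) (hF : ForbidsObstructions G)
    (hA : HasUniformAttachment G) {x y s : V} (hx : x ∈ X) (hy : y ∈ X) (hs : s ∈ S)
    (hxy : G.Adj x y) (hxs : G.Adj x s) : G.Adj y s := by
  obtain ⟨d, hd⟩ := h.symm.nonempty hF
  obtain ⟨t, ht, hyt⟩ := h.exists_adj hF hy
  have hne : ∀ z ∈ X, z ≠ d := by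
    rintro z hz rfl
    exact h.disj z (.inl hz) (.inl hd)
  exact (hA.of_adj (fun h' => h.xd x hx d (.inl hd) h'.symm)
    (fun h' => h.xd y hy d (.inl hd) h'.symm) (hne x hx) (hne y hy) hxy (h.sd s hs d hd).symm
    hxs.symm (h.sd t ht d hd).symm hyt.symm).symm

lemma subset_of_isClique (h : IsSplitObstruction G X S D E) {Q : Set V}
    (hQW : Q ⊆ X ∪ S ∪ (D ∪ E)) (hQ : G.IsClique Q) {p q : V} (hp : p ∈ Q) (hq : q ∈ Q)
    (hpl : p ∈ X ∪ S) (hqr : q ∈ D ∪ E) : Q ⊆ S ∪ D := by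
  intro v hv
  rcases hQW hv with (hx | hs) | (hd | he)
  · refine (h.xd v hx q hqr (hQ hv hq ?_)).elim
    rintro rfl
    exact h.disj v (.inl hx) hqr
  · exact .inl hs
  · exact .inr hd
  · refine (h.se v he p hpl (hQ hv hp ?_)).elim
    rintro rfl
    exact h.disj v hpl (.inr he)

/-- The common neighbours in `S` of an edge inside `X` form a clique. -/
lemma adj_of_common (h : IsSplitObstruction G X S D E) (hF : ForbidsObstructions G)
    (hA : HasUniformAttachment G) {x y a b : V} (hx : x ∈ X) (hy : y ∈ X) (ha : a ∈ S)
    (hb : b ∈ S) (hxy : G.Adj x y) (hxa : G.Adj x a) (hxb : G.Adj x b) (hab : a ≠ b) :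
    G.Adj a b := by
  by_contra nab
  have hya := h.adj_of_adj hF hA hx hy ha hxy hxa
  have hyb := h.adj_of_adj hF hA hx hy hb hxy hxb
  -- An edge inside `D` leads to $G_5$; a triangle with one vertex in `D` and two in `E` leads to
  -- $G_7$.
  rcases h.symm.triangle_shape hF with ⟨c, hc, d, hd, hcd⟩ | ⟨d, hd, e, he, f, hf, hde, hdf, hef⟩
  · refine hF.two_edges hab nab hxy hcd (h.xd x hx c (.inl hc)) (h.xd x hx d (.inl hd))
      (h.xd y hy c (.inl hc)) (h.xd y hy d (.inl hd)) ?_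
    rintro u (rfl | rfl) v (rfl | rfl | rfl | rfl)
    exacts [hxa.symm, hya.symm, h.sd _ ha _ hc, h.sd _ ha _ hd, hxb.symm, hyb.symm,
      h.sd _ hb _ hc, h.sd _ hb _ hd]
  · refine hF.diamond_triangle hab nab hxy hxa hya hxb hyb (h.sd a ha d hd) (h.sd b hb d hd)
      hde hdf hef (h.xd x hx d (.inl hd)) (h.xd y hy d (.inl hd)) ?_
    have hm : ∀ v ∈ ({x, y, a, b} : Set V), v ∈ X ∪ S := by
      rintro v (rfl | rfl | rfl | rfl)
      exacts [.inl hx, .inl hy, .inr ha, .inr hb]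
    rintro v hv w (rfl | rfl) hvw
    · exact h.se _ he v (hm v hv) hvw.symm
    · exact h.se _ hf v (hm v hv) hvw.symm

/-- For non-adjacent `u` and `v`, `adj_of_common` and `adj_of_adj` exclude all edges between their
triangles, leaving a copy of $2K_3$. -/
lemma isClique_edgeAttachment (h : IsSplitObstruction G X S D E) (hF : ForbidsObstructions G)
    (hA : HasUniformAttachment G) : G.IsClique (edgeAttachment G X S) := by
  rintro u ⟨hu, x, hx, y, hy, hxy, hxu, hyu⟩ v ⟨hv, z, hz, w, hw, hzw, hzv, hwv⟩ huv
  by_contra nuv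
  have hxv : ¬ G.Adj x v := fun h' => nuv (h.adj_of_common hF hA hx hy hu hv hxy hxu h' huv)
  have hyv : ¬ G.Adj y v := fun h' => nuv (h.adj_of_common hF hA hy hx hu hv hxy.symm hyu h' huv)
  have hzu : ¬ G.Adj z u := fun h' =>
    nuv (h.adj_of_common hF hA hz hw hv hu hzw hzv h' huv.symm).symm
  have hwu : ¬ G.Adj w u := fun h' =>
    nuv (h.adj_of_common hF hA hw hz hv hu hzw.symm hwv h' huv.symm).symm
  refine hF.two_triangles hxy hxu hyu hzw hzv hwv ?_
  rintro p (rfl | rfl | rfl) q (rfl | rfl | rfl)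
  · exact fun h' => hxv (h.adj_of_adj hF hA hz hx hv h'.symm hzv)
  · exact fun h' => hxv (h.adj_of_adj hF hA hw hx hv h'.symm hwv)
  · exact hxv
  · exact fun h' => hyv (h.adj_of_adj hF hA hz hy hv h'.symm hzv)
  · exact fun h' => hyv (h.adj_of_adj hF hA hw hy hv h'.symm hwv)
  · exact hyv
  · exact fun h' => hzu h'.symm
  · exact fun h' => hwu h'.symm
  · exact nuv

/-- A triangle lies on one side or inside `S ∪ D`. -/
lemma triangle_cases (h : IsSplitObstruction G X S D E) {a b c : V}
    (ha : a ∈ X ∪ S ∪ (D ∪ E)) (hb : b ∈ X ∪ S ∪ (D ∪ E)) (hc : c ∈ X ∪ S ∪ (D ∪ E))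
    (hab : G.Adj a b) (hac : G.Adj a c) (hbc : G.Adj b c) :
    (a ∈ X ∪ S ∧ b ∈ X ∪ S ∧ c ∈ X ∪ S) ∨ (a ∈ D ∪ E ∧ b ∈ D ∪ E ∧ c ∈ D ∪ E) ∨
      (a ∈ S ∪ D ∧ b ∈ S ∪ D ∧ c ∈ S ∪ D) := by
  have key : ∀ u ∈ X ∪ S, ∀ v ∈ D ∪ E, G.Adj u v → u ∈ S ∧ v ∈ D := by
    rintro u (hu | hu) v (hv | hv) huv
    · exact (h.xd u hu v (.inl hv) huv).elim
    · exact (h.xd u hu v (.inr hv) huv).elim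
    · exact ⟨hu, hv⟩
    · exact (h.se v hv u (.inr hu) huv.symm).elim
  rcases ha with ha | ha <;> rcases hb with hb | hb <;> rcases hc with hc | hc
  · exact .inl ⟨ha, hb, hc⟩
  · exact .inr (.inr ⟨.inl (key a ha c hc hac).1, .inl (key b hb c hc hbc).1,
      .inr (key a ha c hc hac).2⟩)
  · exact .inr (.inr ⟨.inl (key a ha b hb hab).1, .inr (key a ha b hb hab).2,
      .inl (key c hc b hb hbc.symm).1⟩)
  · exact .inr (.inr ⟨.inl (key a ha b hb hab).1, .inr (key a ha b hb hab).2,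
      .inr (key a ha c hc hac).2⟩)
  · exact .inr (.inr ⟨.inr (key b hb a ha hab.symm).2, .inl (key b hb a ha hab.symm).1,
      .inl (key c hc a ha hac.symm).1⟩)
  · exact .inr (.inr ⟨.inr (key b hb a ha hab.symm).2, .inl (key b hb a ha hab.symm).1,
      .inr (key b hb c hc hbc).2⟩)
  · exact .inr (.inr ⟨.inr (key c hc a ha hac.symm).2, .inr (key c hc b hb hbc.symm).2,
      .inl (key c hc a ha hac.symm).1⟩)
  · exact .inr (.inl ⟨ha, hb, hc⟩)

/-- A triangle of the side `X ∪ S` outside a set containing all attachments of edges of `X` has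
two vertices in `S`. -/
lemma exists_edge_of_triangle (h : IsSplitObstruction G X S D E) (hF : ForbidsObstructions G)
    {K : Set V} (hK : edgeAttachment G X S ⊆ K) {a b c : V} (ha : a ∈ X ∪ S) (hb : b ∈ X ∪ S)
    (hc : c ∈ X ∪ S) (haK : a ∉ K) (hbK : b ∉ K) (hcK : c ∉ K) (hab : G.Adj a b)
    (hac : G.Adj a c) (hbc : G.Adj b c) :
    ∃ s ∈ S \ K, ∃ t ∈ S \ K, ∃ v ∈ (X ∪ S) \ K, G.Adj s t ∧ G.Adj v s ∧ G.Adj v t := by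
  have hm := h.meets hF ha hb hc hab hac hbc
  have key : ∀ s ∈ S, ∀ x, x ∉ S → ∀ y, y ∉ S → x ∈ X ∪ S → y ∈ X ∪ S → G.Adj x y → G.Adj x s →
      G.Adj y s → s ∈ K := fun s hs x hx y hy hx' hy' h1 h2 h3 =>
    hK ⟨hs, x, hx'.resolve_right hx, y, hy'.resolve_right hy, h1, h2, h3⟩
  by_cases h1 : a ∈ S <;> by_cases h2 : b ∈ S <;> by_cases h3 : c ∈ S
  · exact ⟨a, ⟨h1, haK⟩, b, ⟨h2, hbK⟩, c, ⟨hc, hcK⟩, hab, hac.symm, hbc.symm⟩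
  · exact ⟨a, ⟨h1, haK⟩, b, ⟨h2, hbK⟩, c, ⟨hc, hcK⟩, hab, hac.symm, hbc.symm⟩
  · exact ⟨a, ⟨h1, haK⟩, c, ⟨h3, hcK⟩, b, ⟨hb, hbK⟩, hac, hab.symm, hbc⟩
  · exact absurd (key a h1 b h2 c h3 hb hc hbc hab.symm hac.symm) haK
  · exact ⟨b, ⟨h2, hbK⟩, c, ⟨h3, hcK⟩, a, ⟨ha, haK⟩, hbc, hab, hac⟩
  · exact absurd (key b h2 a h1 c h3 ha hc hac hab hbc.symm) hbK
  · exact absurd (key c h3 a h1 b h2 ha hb hab hac hbc) hcK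
  · tauto

/-- A non-adjacent pair `c`, `d` in `D` makes `S` threshold. If an edge `pq` of `S` were not
dominated by an attachment `u` of an edge `xy`, then `p`, `q`, `c`, `d`, `u`, `x`, `y` would induce
$G_7$; so the splitting clique can absorb all attachments. -/
lemma exists_isClique_of_not_isClique [Finite V] (h : IsSplitObstruction G X S D E)
    (hF : ForbidsObstructions G) (hA : HasUniformAttachment G) (hD : ¬ G.IsClique D) :
    ∃ K, edgeAttachment G X S ⊆ K ∧ K ⊆ S ∧ G.IsClique K ∧
      ∀ p ∈ S \ K, ∀ q ∈ S \ K, ¬ G.Adj p q := by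
  obtain ⟨c, hc, d, hd, hcd, ncd⟩ := exists_pair_of_not_isClique hD
  refine (hF.isThresholdOn hA hcd ncd (fun p hp => (h.sd p hp c hc).symm)
    (fun p hp => (h.sd p hp d hd).symm)).exists_isClique (fun s hs => hs.1)
    (h.isClique_edgeAttachment hF hA) ?_
  rintro u ⟨hu, x, hx, y, hy, hxy, hxu, hyu⟩ p hp q hq hpq
  by_contra! hcon
  obtain ⟨n1, n2, n3, n4⟩ := hcon
  have hn : ∀ z ∈ X, ∀ w ∈ X, G.Adj z w → G.Adj z u → ¬ G.Adj p z ∧ ¬ G.Adj q z := by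
    intro z hz w hw hzw hzu
    exact ⟨fun h' => n3 (h.adj_of_common hF hA hz hw hu hp hzw hzu h'.symm n1),
      fun h' => n4 (h.adj_of_common hF hA hz hw hu hq hzw hzu h'.symm n2)⟩
  have hnx := hn x hx y hy hxy hxu
  have hny := hn y hy x hx hxy.symm hyu
  refine hF.diamond_triangle hcd ncd hpq (h.sd p hp c hc) (h.sd q hq c hc) (h.sd p hp d hd)
    (h.sd q hq d hd) (h.sd u hu c hc).symm (h.sd u hu d hd).symm hxu.symm hyu.symm hxy
    (fun h' => n3 h'.symm) (fun h' => n4 h'.symm) ?_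
  rintro v (rfl | rfl | rfl | rfl) w (rfl | rfl)
  exacts [hnx.1, hny.1, hnx.2, hny.2, fun h' => h.xd _ hx _ (.inl hc) h'.symm,
    fun h' => h.xd _ hy _ (.inl hc) h'.symm, fun h' => h.xd _ hx _ (.inl hd) h'.symm,
    fun h' => h.xd _ hy _ (.inl hd) h'.symm]

/-- Otherwise both sets split, with cliques `K` and `L` absorbing the edge attachments. A triangle
within one side that avoids `K ∪ L` would have an edge in a stable remainder, and one inside `S ∪ D`
would lie in two stable sets. -/
lemma isClique_or_isClique [Finite V] (h : IsSplitObstruction G X S D E)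
    (hF : ForbidsObstructions G) (hA : HasUniformAttachment G) :
    G.IsClique S ∨ G.IsClique D := by
  by_contra! hcon
  obtain ⟨K, hUK, hKS, hK, hKi⟩ := h.exists_isClique_of_not_isClique hF hA hcon.2
  obtain ⟨L, hUL, hLD, hL, hLi⟩ := h.symm.exists_isClique_of_not_isClique hF hA hcon.1
  refine h.not_hasTransversal ⟨K ∪ L, ?_,
    hK.union_of_complete hL fun p hp q hq => h.sd p (hKS hp) q (hLD hq), ?_⟩
  · rintro v (hv | hv)
    exacts [.inl (.inr (hKS hv)), .inr (.inl (hLD hv))]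
  intro a ha b hb c hc hab hac hbc
  by_contra! hcon
  simp only [Set.mem_union, not_or] at hcon
  obtain ⟨⟨a1, a2⟩, ⟨b1, b2⟩, c1, c2⟩ := hcon
  rcases h.triangle_cases ha hb hc hab hac hbc with ⟨a3, b3, c3⟩ | ⟨a3, b3, c3⟩ | ⟨a3, b3, c3⟩
  · obtain ⟨s, hs, t, ht, -, -, hst, -⟩ :=
      h.exists_edge_of_triangle hF hUK a3 b3 c3 a1 b1 c1 hab hac hbc
    exact hKi s hs t ht hst
  · obtain ⟨s, hs, t, ht, -, -, hst, -⟩ :=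
      h.symm.exists_edge_of_triangle hF hUL a3.symm b3.symm c3.symm a2 b2 c2 hab hac hbc
    exact hLi s hs t ht hst
  · exact triangleFreeOn_union_of_isIndep hKi hLi a (a3.imp (⟨·, a1⟩) (⟨·, a2⟩)) b
      (b3.imp (⟨·, b1⟩) (⟨·, b2⟩)) c (c3.imp (⟨·, c1⟩) (⟨·, c2⟩)) hab hac hbc

/-- If `S` is a clique, no clique inside `D` meets all triangles of the side `D ∪ E`. -/
lemma not_isClique_of_transversal (h : IsSplitObstruction G X S D E) (hF : ForbidsObstructions G)
    (hS : G.IsClique S) {L : Set V} (hLD : L ⊆ D)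
    (hT : ∀ a ∈ D ∪ E, ∀ b ∈ D ∪ E, ∀ c ∈ D ∪ E, G.Adj a b → G.Adj a c → G.Adj b c →
      a ∈ L ∨ b ∈ L ∨ c ∈ L) : ¬ G.IsClique L := by
  intro hL
  refine h.not_hasTransversal ⟨S ∪ L, ?_,
    hS.union_of_complete hL fun p hp q hq => h.sd p hp q (hLD hq), ?_⟩
  · rintro v (hv | hv)
    exacts [.inl (.inr hv), .inr (.inl (hLD hv))]
  intro a ha b hb c hc hab hac hbc
  rcases h.triangle_cases ha hb hc hab hac hbc with ⟨a3, b3, c3⟩ | ⟨a3, b3, c3⟩ | ⟨a3, b3, c3⟩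
  · exact (h.meets hF a3 b3 c3 hab hac hbc).imp .inl (Or.imp .inl .inl)
  · exact (hT a a3 b b3 c c3 hab hac hbc).imp .inr (Or.imp .inr .inr)
  · by_contra! hcon
    simp only [Set.mem_union, not_or] at hcon
    obtain ⟨⟨a1, a2⟩, ⟨b1, b2⟩, c1, c2⟩ := hcon
    have := hT a (.inl (a3.resolve_left a1)) b (.inl (b3.resolve_left b1)) c
      (.inl (c3.resolve_left c1)) hab hac hbc
    tauto

/-- Deleting a nonempty part of `D` leaves a clique inside `D` meeting the remaining triangles of
the side `D ∪ E`. -/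
lemma exists_isClique_of_subset (h : IsSplitObstruction G X S D E) {R : Set V} (hRD : R ⊆ D)
    (hR : R.Nonempty) : ∃ Q ⊆ D \ R, G.IsClique Q ∧
      ∀ a ∈ (D ∪ E) \ R, ∀ b ∈ (D ∪ E) \ R, ∀ c ∈ (D ∪ E) \ R, G.Adj a b → G.Adj a c →
        G.Adj b c → a ∈ Q ∨ b ∈ Q ∨ c ∈ Q := by
  by_cases hfree : TriangleFreeOn G ((D ∪ E) \ R)
  · exact ⟨∅, Set.empty_subset _, by simp, fun a ha b hb c hc h1 h2 h3 =>
      (hfree a ha b hb c hc h1 h2 h3).elim⟩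
  obtain ⟨r, hr⟩ := hR
  obtain ⟨Q, hQW, hQ, hT⟩ := h.minimal ((X ∪ S ∪ (D ∪ E)) \ R)
    ⟨Set.sdiff_subset, fun hs => (hs (.inr (.inl (hRD hr)))).2 hr⟩
  have hml : ∀ v ∈ X ∪ S, v ∈ (X ∪ S ∪ (D ∪ E)) \ R := fun v hv =>
    ⟨.inl hv, fun hvR => h.disj v hv (.inl (hRD hvR))⟩
  have hmr : ∀ v ∈ (D ∪ E) \ R, v ∈ (X ∪ S ∪ (D ∪ E)) \ R := fun v hv => ⟨.inr hv.1, hv.2⟩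
  obtain ⟨p, hp, hpl⟩ : ∃ p ∈ Q, p ∈ X ∪ S := by
    obtain ⟨a, ha, b, hb, c, hc, hab, hac, hbc⟩ :=
      exists_triangle_of_not_triangleFreeOn h.triangle_left
    rcases hT a (hml a ha) b (hml b hb) c (hml c hc) hab hac hbc with h' | h' | h'
    exacts [⟨a, h', ha⟩, ⟨b, h', hb⟩, ⟨c, h', hc⟩]
  obtain ⟨q, hq, hqr⟩ : ∃ q ∈ Q, q ∈ D ∪ E := by
    obtain ⟨a, ha, b, hb, c, hc, hab, hac, hbc⟩ := exists_triangle_of_not_triangleFreeOn hfree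
    rcases hT a (hmr a ha) b (hmr b hb) c (hmr c hc) hab hac hbc with h' | h' | h'
    exacts [⟨a, h', ha.1⟩, ⟨b, h', hb.1⟩, ⟨c, h', hc.1⟩]
  -- A clique meeting both sides has no vertex in `X` or `E`, so its trace on the right side lies in
  -- `D`.
  have hsub := h.subset_of_isClique (hQW.trans Set.sdiff_subset) hQ hp hq hpl hqr
  have hmem : ∀ v ∈ (D ∪ E) \ R, v ∈ Q → v ∈ Q ∩ D := fun v hv hvQ =>
    ⟨hvQ, (hsub hvQ).resolve_left fun hvS => h.disj v (.inr hvS) hv.1⟩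
  refine ⟨Q ∩ D, fun v hv => ⟨hv.2, (hQW hv.1).2⟩, hQ.subset Set.inter_subset_left, ?_⟩
  intro a ha b hb c hc hab hac hbc
  exact (hT a (hmr a ha) b (hmr b hb) c (hmr c hc) hab hac hbc).imp (hmem a ha)
    (Or.imp (hmem b hb) (hmem c hc))

/-- A vertex `d` adjacent to all the rest of `D` could be added to the clique obtained after
deleting `d`, giving a clique that `not_isClique_of_transversal` excludes. -/
lemma exists_not_adj (h : IsSplitObstruction G X S D E) (hF : ForbidsObstructions G)
    (hS : G.IsClique S) {d : V} (hd : d ∈ D) : ∃ e ∈ D, e ≠ d ∧ ¬ G.Adj d e := by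
  by_contra! hcon
  obtain ⟨Q, hQD, hQ, hT⟩ := h.exists_isClique_of_subset (R := {d}) (by simpa using hd)
    (Set.singleton_nonempty d)
  refine h.not_isClique_of_transversal hF hS (L := insert d Q)
    (Set.insert_subset hd (hQD.trans Set.sdiff_subset)) ?_
    (hQ.insert fun b hb hne => hcon b (hQD hb).1 hne.symm)
  intro a ha b hb c hc hab hac hbc
  by_cases h1 : a = d
  · exact .inl (.inl h1)
  by_cases h2 : b = d
  · exact .inr (.inl (.inl h2))
  by_cases h3 : c = d
  · exact .inr (.inr (.inl h3))
  exact (hT a ⟨ha, h1⟩ b ⟨hb, h2⟩ c ⟨hc, h3⟩ hab hac hbc).imp .inr (Or.imp .inr .inr)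

end IsSplitObstruction

/-! ### Split obstructions: excluding a clique as attachment set -/

namespace IsSplitObstruction

variable {V : Type*} {G : SimpleGraph V} {X S D E : Set V}

lemma exists_triangle_of_mem (h : IsSplitObstruction G X S D E) (hF : ForbidsObstructions G)
    (hS : G.IsClique S) {R : Set V} (hRD : R ⊆ D) (hR : R.Nonempty) :
    ∃ r ∈ R, ∃ b ∈ D ∪ E, ∃ c ∈ D ∪ E, G.Adj r b ∧ G.Adj r c ∧ G.Adj b c := by
  by_contra! hcon
  obtain ⟨Q, hQD, hQ, hT⟩ := h.exists_isClique_of_subset hRD hR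
  refine h.not_isClique_of_transversal hF hS (hQD.trans Set.sdiff_subset) ?_ hQ
  intro a ha b hb c hc hab hac hbc
  exact hT a ⟨ha, fun h' => hcon a h' b hb c hc hab hac hbc⟩
    b ⟨hb, fun h' => hcon b h' a ha c hc hab.symm hbc hac⟩
    c ⟨hc, fun h' => hcon c h' a ha b hb hac.symm hbc.symm hab⟩ hab hac hbc

/-- If `x` were adjacent to `r`, uniform attachment seen from `p` would make it adjacent to `s` as
well; then `x` and any `d` in `D` joined to the edges `pq` and `rs` form $G_5$. -/
lemma not_adj_of_separate_edges (h : IsSplitObstruction G X S D E) (hF : ForbidsObstructions G)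
    (hA : HasUniformAttachment G) {A B : Set V} (hAS : A ⊆ S) (hBS : B ⊆ S)
    (hAB : ∀ a ∈ A, ∀ b ∈ B, a ≠ b ∧ ¬ G.Adj a b) {x p q r s : V} (hx : x ∈ X) (hp : p ∈ A)
    (hq : q ∈ A) (hr : r ∈ B) (hs : s ∈ B) (hpq : G.Adj p q) (hrs : G.Adj r s) (hxp : G.Adj x p)
    (hxq : G.Adj x q) : ¬ G.Adj x r := by
  intro hxr
  obtain ⟨d, hd⟩ := h.symm.nonempty hF
  have hxs : G.Adj x s := hA.of_adj (hAB p hp r hr).2 (hAB p hp s hs).2 (hAB p hp r hr).1.symm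
    (hAB p hp s hs).1.symm hrs hxp.symm hxr (h.sd p (hAS hp) d hd) (h.sd s (hBS hs) d hd).symm
  refine hF.two_edges (a := d) (b := x) ?_ (fun h' => h.xd x hx d (.inl hd) h'.symm) hpq hrs
    (hAB p hp r hr).2 (hAB p hp s hs).2 (hAB q hq r hr).2 (hAB q hq s hs).2 ?_
  · rintro rfl
    exact h.disj d (.inl hx) (.inl hd)
  · rintro u (rfl | rfl) v (rfl | rfl | rfl | rfl)
    exacts [(h.sd _ (hAS hp) _ hd).symm, (h.sd _ (hAS hq) _ hd).symm, (h.sd _ (hBS hr) _ hd).symm,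
      (h.sd _ (hBS hs) _ hd).symm, hxp, hxq, hxr, hxs]

lemma not_adj_of_separate (h : IsSplitObstruction G X S D E) (hF : ForbidsObstructions G)
    (hA : HasUniformAttachment G) {A B : Set V} (hAS : A ⊆ S) (hBS : B ⊆ S)
    (hAB : ∀ a ∈ A, ∀ b ∈ B, a ≠ b ∧ ¬ G.Adj a b) {x y p r : V} (hx : x ∈ X) (hy : y ∈ X)
    (hxy : G.Adj x y) (hp : p ∈ A) (hr : r ∈ B) (hxp : G.Adj x p) : ¬ G.Adj x r := fun hxr =>
  (hAB p hp r hr).2 (h.adj_of_common hF hA hx hy (hAS hp) (hBS hr) hxy hxp hxr (hAB p hp r hr).1)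

/-- Triangles with an edge in `A` and with an edge in `B` do not coexist, where `A` and `B` are
anticomplete parts of `S`. -/
lemma false_of_edge_edge (h : IsSplitObstruction G X S D E) (hF : ForbidsObstructions G)
    (hA : HasUniformAttachment G) {A B : Set V} (hAS : A ⊆ S) (hBS : B ⊆ S)
    (hAB : ∀ a ∈ A, ∀ b ∈ B, a ≠ b ∧ ¬ G.Adj a b) {p q t p' q' t' : V} (hp : p ∈ A) (hq : q ∈ A)
    (ht : t ∈ A ∪ X) (hpq : G.Adj p q) (hpt : G.Adj p t) (hqt : G.Adj q t) (hp' : p' ∈ B)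
    (hq' : q' ∈ B) (ht' : t' ∈ B ∪ X) (hpq' : G.Adj p' q') (hpt' : G.Adj p' t')
    (hqt' : G.Adj q' t') : False := by
  have hBA : ∀ b ∈ B, ∀ a ∈ A, b ≠ a ∧ ¬ G.Adj b a := fun b hb a ha =>
    ⟨(hAB a ha b hb).1.symm, fun h' => (hAB a ha b hb).2 h'.symm⟩
  have n1 : ¬ G.Adj t p' := ht.elim (fun ht => (hAB t ht p' hp').2) fun ht =>
    h.not_adj_of_separate_edges hF hA hAS hBS hAB ht hp hq hp' hq' hpq hpq' hpt.symm hqt.symm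
  have n2 : ¬ G.Adj t q' := ht.elim (fun ht => (hAB t ht q' hq').2) fun ht =>
    h.not_adj_of_separate_edges hF hA hAS hBS hAB ht hp hq hq' hp' hpq hpq'.symm hpt.symm hqt.symm
  have n3 : ¬ G.Adj t' p := ht'.elim (fun ht => (hBA t' ht p hp).2) fun ht =>
    h.not_adj_of_separate_edges hF hA hBS hAS hBA ht hp' hq' hp hq hpq' hpq hpt'.symm hqt'.symm
  have n4 : ¬ G.Adj t' q := ht'.elim (fun ht => (hBA t' ht q hq).2) fun ht =>
    h.not_adj_of_separate_edges hF hA hBS hAS hBA ht hp' hq' hq hp hpq' hpq.symm hpt'.symm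
      hqt'.symm
  have n5 : ¬ G.Adj t t' := by
    intro htt
    rcases ht with ht | ht <;> rcases ht' with ht' | ht'
    · exact (hAB t ht t' ht').2 htt
    · exact h.not_adj_of_separate_edges hF hA hBS hAS hBA ht' hp' hq' ht hp hpq' hpt.symm
        hpt'.symm hqt'.symm htt.symm
    · exact h.not_adj_of_separate_edges hF hA hAS hBS hAB ht hp hq ht' hp' hpq hpt'.symm
        hpt.symm hqt.symm htt
    · exact n1 (h.adj_of_adj hF hA ht' ht (hBS hp') htt.symm hpt'.symm)
  refine hF.two_triangles hpq hpt hqt hpq' hpt' hqt' ?_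
  rintro u (rfl | rfl | rfl) v (rfl | rfl | rfl)
  exacts [(hAB _ hp _ hp').2, (hAB _ hp _ hq').2, fun h' => n3 h'.symm, (hAB _ hq _ hp').2,
    (hAB _ hq _ hq').2, fun h' => n4 h'.symm, n1, n2, n5]

lemma false_of_edge_vertex (h : IsSplitObstruction G X S D E) (hF : ForbidsObstructions G)
    (hA : HasUniformAttachment G) {A B : Set V} (hAS : A ⊆ S) (hBS : B ⊆ S)
    (hAB : ∀ a ∈ A, ∀ b ∈ B, a ≠ b ∧ ¬ G.Adj a b) {p q t r x y : V} (hp : p ∈ A) (hq : q ∈ A)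
    (ht : t ∈ A ∪ X) (hpq : G.Adj p q) (hpt : G.Adj p t) (hqt : G.Adj q t) (hr : r ∈ B)
    (hx : x ∈ X) (hy : y ∈ X) (hrx : G.Adj r x) (hry : G.Adj r y) (hxy : G.Adj x y) : False := by
  have hBA : ∀ b ∈ B, ∀ a ∈ A, b ≠ a ∧ ¬ G.Adj b a := fun b hb a ha =>
    ⟨(hAB a ha b hb).1.symm, fun h' => (hAB a ha b hb).2 h'.symm⟩
  have nx : ∀ a ∈ A, ¬ G.Adj x a := fun a ha =>
    h.not_adj_of_separate hF hA hBS hAS hBA hx hy hxy hr ha hrx.symm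
  have ny : ∀ a ∈ A, ¬ G.Adj y a := fun a ha =>
    h.not_adj_of_separate hF hA hBS hAS hBA hy hx hxy.symm hr ha hry.symm
  have ntx : ¬ G.Adj t x := fun h' => ht.elim (fun ht => nx t ht h'.symm) fun ht =>
    nx p hp (h.adj_of_adj hF hA ht hx (hAS hp) h' hpt.symm)
  have nty : ¬ G.Adj t y := fun h' => ht.elim (fun ht => ny t ht h'.symm) fun ht =>
    ny p hp (h.adj_of_adj hF hA ht hy (hAS hp) h' hpt.symm)
  obtain ⟨d, hd⟩ := h.symm.nonempty hF
  -- If `t` is adjacent to `r`, the diamond `p`, `q`, `t`, `d` and the triangle at `r` form $G_7$;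
  -- otherwise the two triangles form $G_1$.
  by_cases htr : G.Adj t r
  · have htX : t ∈ X := ht.resolve_left fun ht => (hAB t ht r hr).2 htr
    refine hF.diamond_triangle (x := p) (y := q) (a := t) (b := d) ?_ (h.xd t htX d (.inl hd)) hpq
      hpt hqt (h.sd p (hAS hp) d hd) (h.sd q (hAS hq) d hd) htr (h.sd r (hBS hr) d hd).symm hrx hry
      hxy (hAB p hp r hr).2 (hAB q hq r hr).2 ?_
    · rintro rfl
      exact h.disj t (.inl htX) (.inl hd)
    · rintro v (rfl | rfl | rfl | rfl) w (rfl | rfl)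
      exacts [fun h' => nx _ hp h'.symm, fun h' => ny _ hp h'.symm, fun h' => nx _ hq h'.symm,
        fun h' => ny _ hq h'.symm, ntx, nty, fun h' => h.xd _ hx _ (.inl hd) h'.symm,
        fun h' => h.xd _ hy _ (.inl hd) h'.symm]
  · refine hF.two_triangles hpq hpt hqt hrx hry hxy ?_
    rintro v (rfl | rfl | rfl) w (rfl | rfl | rfl)
    exacts [(hAB _ hp _ hr).2, fun h' => nx _ hp h'.symm, fun h' => ny _ hp h'.symm,
      (hAB _ hq _ hr).2, fun h' => nx _ hq h'.symm, fun h' => ny _ hq h'.symm, htr, ntx, nty]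

lemma false_of_vertex_vertex (h : IsSplitObstruction G X S D E) (hF : ForbidsObstructions G)
    (hA : HasUniformAttachment G) {A B : Set V} (hAS : A ⊆ S) (hBS : B ⊆ S)
    (hAB : ∀ a ∈ A, ∀ b ∈ B, a ≠ b ∧ ¬ G.Adj a b) {p x y r z w : V} (hp : p ∈ A) (hx : x ∈ X)
    (hy : y ∈ X) (hpx : G.Adj p x) (hpy : G.Adj p y) (hxy : G.Adj x y) (hr : r ∈ B) (hz : z ∈ X)
    (hw : w ∈ X) (hrz : G.Adj r z) (hrw : G.Adj r w) (hzw : G.Adj z w) : False :=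
  (hAB p hp r hr).2 (h.isClique_edgeAttachment hF hA ⟨hAS hp, x, hx, y, hy, hxy, hpx.symm, hpy.symm⟩
    ⟨hBS hr, z, hz, w, hw, hzw, hrz.symm, hrw.symm⟩ (hAB p hp r hr).1)

lemma shape_of_triangle {A B : Set V} (hS : A ∪ B = S)
    (hAB : ∀ a ∈ A, ∀ b ∈ B, a ≠ b ∧ ¬ G.Adj a b) {a b c : V} (ha : a ∈ A) (hb : b ∈ S ∪ X)
    (hc : c ∈ S ∪ X) (hab : G.Adj a b) (hac : G.Adj a c) (hbc : G.Adj b c) :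
    (∃ p ∈ A, ∃ q ∈ A, ∃ t ∈ A ∪ X, G.Adj p q ∧ G.Adj p t ∧ G.Adj q t) ∨
      ∃ p ∈ A, ∃ x ∈ X, ∃ y ∈ X, G.Adj p x ∧ G.Adj p y ∧ G.Adj x y := by
  have key : ∀ v ∈ S ∪ X, G.Adj a v → v ∈ A ∨ v ∈ X := by
    intro v hv hav
    rw [← hS] at hv
    rcases hv with (hv | hv) | hv
    exacts [.inl hv, ((hAB a ha v hv).2 hav).elim, .inr hv]
  rcases key b hb hab with hb' | hb'
  · exact .inl ⟨a, ha, b, hb', c, key c hc hac, hab, hac, hbc⟩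
  · rcases key c hc hac with hc' | hc'
    · exact .inl ⟨a, ha, c, hc', b, .inr hb', hac, hab, hbc.symm⟩
    · exact .inr ⟨a, ha, b, hb', c, hc', hab, hac, hbc⟩

/-- By minimality each of `A` and `B` has a vertex in a triangle of the side `X ∪ S`. Such a
triangle has either an edge in the part or just one vertex there and two in `X`; every combination
of shapes is contradictory. -/
lemma not_anticomplete (h : IsSplitObstruction G X S D E) (hF : ForbidsObstructions G)
    (hA : HasUniformAttachment G) (hD : G.IsClique D) {A B : Set V} (hS : A ∪ B = S)
    (hA0 : A.Nonempty) (hB0 : B.Nonempty) (hAB : ∀ a ∈ A, ∀ b ∈ B, a ≠ b ∧ ¬ G.Adj a b) :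
    False := by
  have hAS : A ⊆ S := hS ▸ Set.subset_union_left
  have hBS : B ⊆ S := hS ▸ Set.subset_union_right
  have hBA : ∀ b ∈ B, ∀ a ∈ A, b ≠ a ∧ ¬ G.Adj b a := fun b hb a ha =>
    ⟨(hAB a ha b hb).1.symm, fun h' => (hAB a ha b hb).2 h'.symm⟩
  obtain ⟨a, ha, b, hb, c, hc, hab, hac, hbc⟩ := h.symm.exists_triangle_of_mem hF hD hAS hA0
  obtain ⟨a', ha', b', hb', c', hc', hab', hac', hbc'⟩ :=
    h.symm.exists_triangle_of_mem hF hD hBS hB0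
  rcases shape_of_triangle hS hAB ha hb hc hab hac hbc with
    ⟨p, hp, q, hq, t, ht, h1, h2, h3⟩ | ⟨p, hp, x, hx, y, hy, h1, h2, h3⟩ <;>
  rcases shape_of_triangle (by rw [Set.union_comm, hS]) hBA ha' hb' hc' hab' hac' hbc' with
    ⟨p', hp', q', hq', t', ht', h1', h2', h3'⟩ | ⟨p', hp', x', hx', y', hy', h1', h2', h3'⟩
  · exact h.false_of_edge_edge hF hA hAS hBS hAB hp hq ht h1 h2 h3 hp' hq' ht' h1' h2' h3'
  · exact h.false_of_edge_vertex hF hA hAS hBS hAB hp hq ht h1 h2 h3 hp' hx' hy' h1' h2' h3'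
  · exact h.false_of_edge_vertex hF hA hBS hAS hBA hp' hq' ht' h1' h2' h3' hp hx hy h1 h2 h3
  · exact h.false_of_vertex_vertex hF hA hAS hBS hAB hp hx hy h1 h2 h3 hp' hx' hy' h1' h2' h3'

/-- The argument of `exists_isClique_of_not_isClique` with the non-adjacent pair taken from `R`. The
new point is that a vertex `z` on an attached edge of `u` is adjacent to neither: adjacent to both
it would violate `adj_of_common`, adjacent to one it would start a `P₄` through `e` whose ends share
the neighbour `u`. -/
lemma exists_isClique_of_complete [Finite V] (h : IsSplitObstruction G X S D E)
    (hF : ForbidsObstructions G) (hA : HasUniformAttachment G) {P R : Set V} (hPS : P ⊆ S)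
    (hRS : R ⊆ S) (hPR : ∀ p ∈ P, ∀ r ∈ R, G.Adj p r) (hR : ¬ G.IsClique R) :
    ∃ K, edgeAttachment G X S ∩ P ⊆ K ∧ K ⊆ P ∧ G.IsClique K ∧
      ∀ p ∈ P \ K, ∀ q ∈ P \ K, ¬ G.Adj p q := by
  obtain ⟨c, hc, d, hd, hcd, ncd⟩ := exists_pair_of_not_isClique hR
  obtain ⟨e, he⟩ := h.symm.nonempty hF
  refine (hF.isThresholdOn hA hcd ncd (fun p hp => (hPR p hp c hc).symm)
    (fun p hp => (hPR p hp d hd).symm)).exists_isClique Set.inter_subset_right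
    ((h.isClique_edgeAttachment hF hA).subset Set.inter_subset_left) ?_
  rintro u ⟨⟨hu, x, hx, y, hy, hxy, hxu, hyu⟩, huP⟩ p hp q hq hpq
  by_contra! hcon
  obtain ⟨n1, n2, n3, n4⟩ := hcon
  have hcenter : ∀ z ∈ X, ∀ w ∈ X, G.Adj z w → G.Adj z u → ∀ r ∈ R, ∀ r' ∈ R, r ≠ r' →
      ¬ G.Adj r r' → ¬ G.Adj z r := by
    intro z hz w hw hzw hzu r hr r' hr' hne hn hzr
    have hzr' : ¬ G.Adj z r' := fun hzr' =>
      hn (h.adj_of_common hF hA hz hw (hRS hr) (hRS hr') hzw hzr hzr' hne)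
    exact hA.path_four hzr (h.sd r (hRS hr) e he) (h.sd r' (hRS hr') e he).symm
      (h.xd z hz e (.inl he)) hzr' hn hzu.symm (hPR u huP r' hr')
  have hn : ∀ z ∈ X, ∀ w ∈ X, G.Adj z w → G.Adj z u →
      ¬ G.Adj p z ∧ ¬ G.Adj q z ∧ ¬ G.Adj c z ∧ ¬ G.Adj d z := by
    intro z hz w hw hzw hzu
    exact ⟨fun h' => n3 (h.adj_of_common hF hA hz hw hu (hPS hp) hzw hzu h'.symm n1),
      fun h' => n4 (h.adj_of_common hF hA hz hw hu (hPS hq) hzw hzu h'.symm n2),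
      fun h' => hcenter z hz w hw hzw hzu c hc d hd hcd ncd h'.symm,
      fun h' => hcenter z hz w hw hzw hzu d hd c hc hcd.symm (fun h => ncd h.symm) h'.symm⟩
  have hnx := hn x hx y hy hxy hxu
  have hny := hn y hy x hx hxy.symm hyu
  refine hF.diamond_triangle hcd ncd hpq (hPR p hp c hc) (hPR q hq c hc) (hPR p hp d hd)
    (hPR q hq d hd) (hPR u huP c hc).symm (hPR u huP d hd).symm hxu.symm hyu.symm hxy
    (fun h' => n3 h'.symm) (fun h' => n4 h'.symm) ?_
  rintro v (rfl | rfl | rfl | rfl) w (rfl | rfl)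
  exacts [hnx.1, hny.1, hnx.2.1, hny.2.1, hnx.2.2.1, hny.2.2.1, hnx.2.2.2, hny.2.2.2]

/-- A vertex of `X` is not adjacent to both ends of an edge of `S` that extends to an induced
four-cycle of `S`. -/
lemma not_adj_of_four_cycle (h : IsSplitObstruction G X S D E) (hF : ForbidsObstructions G)
    (hA : HasUniformAttachment G) {x s t s' t' : V} (hx : x ∈ X) (hs : s ∈ S) (ht : t ∈ S)
    (hs' : s' ∈ S) (ht' : t' ∈ S) (hst : G.Adj s t) (hts' : G.Adj t s') (hst' : G.Adj s t')
    (hst'' : G.Adj s' t') (hss : s ≠ s') (nss : ¬ G.Adj s s') (htt : t ≠ t')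
    (ntt : ¬ G.Adj t t') (hxs : G.Adj x s) : ¬ G.Adj x t := by
  intro hxt
  obtain ⟨d, hd⟩ := h.symm.nonempty hF
  have hxs' : G.Adj x s' := by
    by_contra n
    exact hA.path_four hxs (h.sd s hs d hd) (h.sd s' hs' d hd).symm (h.xd x hx d (.inl hd)) n nss
      hxt.symm hts'
  have hxt' : G.Adj x t' := by
    by_contra n
    exact hA.path_four hxt (h.sd t ht d hd) (h.sd t' ht' d hd).symm (h.xd x hx d (.inl hd)) n ntt
      hxs.symm hst'
  refine hF.four_cycle (a := d) (b := x) ?_ (fun h' => h.xd x hx d (.inl hd) h'.symm) hss htt nss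
    ntt hst hts' hst'' hst' ?_
  · rintro rfl
    exact h.disj d (.inl hx) (.inl hd)
  · rintro u (rfl | rfl) v (rfl | rfl | rfl | rfl)
    exacts [(h.sd _ hs _ hd).symm, (h.sd _ ht _ hd).symm, (h.sd _ hs' _ hd).symm,
      (h.sd _ ht' _ hd).symm, hxs, hxt, hxs', hxt']

/-- No vertex of `S` is universal in `S`, so neither part is a clique, and the splitting cliques of
both parts unite to `K ∪ L`. A triangle of `X ∪ S` missing it would consist of an edge between `P`
and `R` and a vertex of `X`; but such an edge lies in an induced four-cycle of `S`, so
`not_adj_of_four_cycle` applies. -/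
lemma not_complete [Finite V] (h : IsSplitObstruction G X S D E) (hF : ForbidsObstructions G)
    (hA : HasUniformAttachment G) (hD : G.IsClique D) {P R : Set V} (hS : P ∪ R = S)
    (hP0 : P.Nonempty) (hR0 : R.Nonempty) (hPR : ∀ p ∈ P, ∀ r ∈ R, G.Adj p r) : False := by
  have hPS : P ⊆ S := hS ▸ Set.subset_union_left
  have hRS : R ⊆ S := hS ▸ Set.subset_union_right
  have hmem : ∀ v ∈ S, v ∈ P ∨ v ∈ R := fun v hv => by rwa [← hS] at hv
  have hPn : ∀ p ∈ P, ∃ q ∈ P, q ≠ p ∧ ¬ G.Adj p q := by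
    intro p hp
    obtain ⟨q, hq, hne, hn⟩ := h.symm.exists_not_adj hF hD (hPS hp)
    exact ⟨q, (hmem q hq).resolve_right fun hqR => hn (hPR p hp q hqR), hne, hn⟩
  have hRn : ∀ p ∈ R, ∃ q ∈ R, q ≠ p ∧ ¬ G.Adj p q := by
    intro p hp
    obtain ⟨q, hq, hne, hn⟩ := h.symm.exists_not_adj hF hD (hRS hp)
    exact ⟨q, (hmem q hq).resolve_left fun hqP => hn (hPR q hqP p hp).symm, hne, hn⟩
  have hncl : ∀ {T : Set V}, T.Nonempty → (∀ p ∈ T, ∃ q ∈ T, q ≠ p ∧ ¬ G.Adj p q) →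
      ¬ G.IsClique T := by
    rintro T ⟨p, hp⟩ hT hcl
    obtain ⟨q, hq, hne, hn⟩ := hT p hp
    exact hn (hcl hp hq hne.symm)
  obtain ⟨K, hUK, hKP, hK, hKi⟩ :=
    h.exists_isClique_of_complete hF hA hPS hRS hPR (hncl hR0 hRn)
  obtain ⟨L, hUL, hLR, hL, hLi⟩ :=
    h.exists_isClique_of_complete hF hA hRS hPS (fun r hr p hp => (hPR p hp r hr).symm)
      (hncl hP0 hPn)
  have hno : ∀ x ∈ X, ∀ p ∈ P, ∀ r ∈ R, G.Adj x p → ¬ G.Adj x r := by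
    intro x hx p hp r hr
    obtain ⟨p', hp', hpp, npp⟩ := hPn p hp
    obtain ⟨r', hr', hrr, nrr⟩ := hRn r hr
    exact h.not_adj_of_four_cycle hF hA hx (hPS hp) (hRS hr) (hPS hp') (hRS hr') (hPR p hp r hr)
      (hPR p' hp' r hr).symm (hPR p hp r' hr') (hPR p' hp' r' hr') hpp.symm npp hrr.symm nrr
  refine h.symm.not_isClique_of_transversal hF hD (L := K ∪ L) ?_ ?_
    (hK.union_of_complete hL fun p hp q hq => hPR p (hKP hp) q (hLR hq))
  · rintro v (hv | hv)
    exacts [hPS (hKP hv), hRS (hLR hv)]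
  intro a ha b hb c hc hab hac hbc
  by_contra! hcon
  have hU : edgeAttachment G X S ⊆ K ∪ L := fun v hv =>
    (hmem v hv.1).imp (fun h' => hUK ⟨hv, h'⟩) fun h' => hUL ⟨hv, h'⟩
  obtain ⟨s, ⟨hsS, hs⟩, t, ⟨htS, ht⟩, v, ⟨hv, hvn⟩, hst, hvs, hvt⟩ :=
    h.exists_edge_of_triangle hF hU ha.symm hb.symm hc.symm hcon.1 hcon.2.1 hcon.2.2 hab hac hbc
  have hout : ∀ w ∈ S, w ∉ K ∪ L → w ∈ P \ K ∪ R \ L := fun w hw hn =>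
    (hmem w hw).imp (fun h' => ⟨h', fun h => hn (.inl h)⟩) fun h' => ⟨h', fun h => hn (.inr h)⟩
  rcases hv with hv | hv
  · rcases hout s hsS hs with hs' | hs' <;> rcases hout t htS ht with ht' | ht'
    · exact hKi s hs' t ht' hst
    · exact hno v hv s hs'.1 t ht'.1 hvs hvt
    · exact hno v hv t ht'.1 s hs'.1 hvt hvs
    · exact hLi s hs' t ht' hst
  · exact triangleFreeOn_union_of_isIndep hKi hLi v (hout v hv hvn) s (hout s hsS hs) t
      (hout t htS ht) hvs hvt hst

lemma not_isClique_right [Finite V] (h : IsSplitObstruction G X S D E)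
    (hF : ForbidsObstructions G) (hA : HasUniformAttachment G) : ¬ G.IsClique D := by
  intro hD
  by_cases hS : G.IsClique S
  · exact h.symm.not_isClique_of_transversal hF hD subset_rfl (fun a ha b hb c hc =>
      h.meets hF ha.symm hb.symm hc.symm) hS
  · obtain ⟨d, hd⟩ := h.symm.nonempty hF
    have hP : IsPathFourFreeOn G S := fun p hp q hq r hr s hs h1 h2 h3 h4 h5 h6 =>
      hA.path_four h1 h2 h3 h4 h5 h6 (h.sd p hp d hd).symm (h.sd s hs d hd).symm
    obtain ⟨A, B, Z, hcut, hZ⟩ := hP.exists_isCutPartition hS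
    rcases Z.eq_empty_or_nonempty with rfl | hne
    · exact h.not_anticomplete hF hA hD (by simpa using hcut.union) hcut.left hcut.right hcut.anti
    · exact h.not_complete hF hA hD (by rw [Set.union_comm, hcut.union]) hne
        (hcut.left.mono Set.subset_union_left) hZ

lemma false [Finite V] (h : IsSplitObstruction G X S D E)
    (hF : ForbidsObstructions G) (hA : HasUniformAttachment G) : False :=
  (h.isClique_or_isClique hF hA).elim (h.symm.not_isClique_right hF hA)
    (h.not_isClique_right hF hA)

end IsSplitObstruction

/-! ### Reduction to split obstructions and conclusion -/

/-- A minimal set without transversal, all of whose vertices lie in triangles, is a split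
obstruction as soon as it contains two vertices at distance at least three. -/
lemma HasUniformAttachment.exists_isSplitObstruction {V : Type*} {G : SimpleGraph V}
    (hA : HasUniformAttachment G) {W : Set V} (hW : ¬ HasTransversal G W)
    (hmin : ∀ W' ⊂ W, HasTransversal G W')
    (hT : ∀ v ∈ W, ∃ a ∈ W, ∃ b ∈ W, G.Adj v a ∧ G.Adj v b ∧ G.Adj a b) {x y : V} (hx : x ∈ W)
    (hy : y ∈ W) (hxy : x ≠ y) (nxy : ¬ G.Adj x y) (hn : ∀ z ∈ W, G.Adj z x → ¬ G.Adj z y) :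
    ∃ X S D E, IsSplitObstruction G X S D E := by
  let step : V → V → Prop := fun u v => G.Adj u v ∧ v ∈ W ∧ v ≠ x ∧ ¬ G.Adj x v
  -- `C` is the component of `y` in `W` minus the closed neighbourhood of `x`. Uniform attachment at
  -- `x` makes `S` complete to `D`. The triangles at `x` and at `y` lie on opposite sides:
  -- neighbours of `x` avoid `C`, while neighbours of `y` in `W` are in `C`.
  let C : Set V := {v | Relation.ReflTransGen step y v}
  have hyC : y ∈ C := Relation.ReflTransGen.refl
  have hCW : ∀ v ∈ C, v ∈ W ∧ v ≠ x ∧ ¬ G.Adj x v := by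
    intro v hv
    rcases Relation.ReflTransGen.cases_tail hv with rfl | ⟨u, -, huv⟩
    · exact ⟨hy, hxy.symm, nxy⟩
    · exact huv.2
  have hCs : ∀ u ∈ C, ∀ v ∈ W, G.Adj u v → v ≠ x → ¬ G.Adj x v → v ∈ C :=
    fun u hu v hv huv h1 h2 => Relation.ReflTransGen.tail hu ⟨huv, hv, h1, h2⟩
  have hreach : ∀ v (hv : v ∈ C), (G.induce C).Reachable ⟨y, hyC⟩ ⟨v, hv⟩ := by
    intro v hv
    induction hv with
    | refl => exact .refl _
    | @tail u v hu huv ih =>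
      exact ih.trans (SimpleGraph.Adj.reachable (G := G.induce C) (u := ⟨u, hu⟩)
        (v := ⟨v, hu.tail huv⟩) huv.1)
  have hconn : (G.induce C).Preconnected := fun u v =>
    (hreach u u.2).symm.trans (hreach v v.2)
  let S : Set V := {a | a ∈ W ∧ G.Adj x a ∧ ∃ c ∈ C, G.Adj a c}
  let D : Set V := {c | c ∈ C ∧ ∃ a ∈ S, G.Adj a c}
  have hSC : ∀ v ∈ S, v ∉ C := fun v hv hvC => (hCW v hvC).2.2 hv.2.1
  have hDE : D ∪ C \ D = C := Set.union_sdiff_cancel fun v hv => hv.1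
  have hXS : W \ (C ∪ S) ∪ S = W \ C := by
    ext v
    have := hSC v
    have : v ∈ S → v ∈ W := fun hv => hv.1
    simp only [Set.mem_union, Set.mem_sdiff]
    tauto
  have hu : W \ (C ∪ S) ∪ S ∪ (D ∪ C \ D) = W := by
    rw [hDE, hXS]
    exact Set.sdiff_union_of_subset fun v hv => (hCW v hv).1
  have hSadj : ∀ v ∈ W, v ∉ C → ∀ c ∈ C, G.Adj v c → v ∈ S := by
    intro v hv hvC c hc hvc
    refine ⟨hv, ?_, c, hc, hvc⟩
    by_contra hxv
    have hvx : v ≠ x := by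
      rintro rfl
      exact (hCW c hc).2.2 hvc
    exact hvC (hCs c hc v hv hvc.symm hvx hxv)
  refine ⟨W \ (C ∪ S), S, D, C \ D, ?_, ?_, ?_, ?_, ?_, ?_, ?_, ?_, ?_⟩
  · rw [hXS, hDE]
    exact fun v hv => hv.2
  · rintro s ⟨hs, hxs, c, hc, hsc⟩ d ⟨hd, t, ht, htd⟩
    exact hA x C hconn (fun k hk => (hCW k hk).2) c hc d hd s t hxs hsc ht.2.1 htd
  · rw [hDE]
    exact fun v hv c hc hvc =>
      hv.2 (.inr (hSadj v hv.1 (fun h' => hv.2 (.inl h')) c hc hvc))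
  · rw [hXS]
    rintro e ⟨he, heD⟩ v hv hev
    exact heD ⟨he, v, hSadj v hv.1 hv.2 e he hev.symm, hev.symm⟩
  · rw [hXS]
    intro hfree
    obtain ⟨a, ha, b, hb, h1, h2, h3⟩ := hT x hx
    exact hfree x ⟨hx, fun h' => (hCW x h').2.1 rfl⟩ a ⟨ha, fun h' => (hCW a h').2.2 h1⟩ b
      ⟨hb, fun h' => (hCW b h').2.2 h2⟩ h1 h2 h3
  · rw [hDE]
    intro hfree
    obtain ⟨a, ha, b, hb, h1, h2, h3⟩ := hT y hy
    have hmem : ∀ v ∈ W, G.Adj y v → v ∈ C := by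
      intro v hv hyv
      refine hCs y hyC v hv hyv ?_ fun hxv => hn v hv hxv.symm hyv.symm
      rintro rfl
      exact nxy hyv.symm
    exact hfree y hyC a (hmem a ha h1) b (hmem b hb h2) h1 h2 h3
  · rw [hu]; exact hT
  · rw [hu]; exact hW
  · rw [hu]; exact hmin

lemma ForbidsObstructions.hasTransversal {V : Type*} [Finite V] {G : SimpleGraph V}
    (hF : ForbidsObstructions G) (hA : HasUniformAttachment G) (W : Set V) :
    HasTransversal G W := by
  induction W using (wellFounded_lt (α := Set V)).induction with
  | _ W ih =>
    have hmin : ∀ W' ⊂ W, HasTransversal G W' := ih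
    by_contra hW
    have hT : ∀ v ∈ W, ∃ a ∈ W, ∃ b ∈ W, G.Adj v a ∧ G.Adj v b ∧ G.Adj a b := by
      intro v hv
      by_contra! hcon
      obtain ⟨Q, hQW, hQ, hT⟩ := hmin (W \ {v}) ⟨Set.sdiff_subset, fun hs => (hs hv).2 rfl⟩
      refine hW ⟨Q, hQW.trans Set.sdiff_subset, hQ, ?_⟩
      intro a ha b hb c hc hab hac hbc
      refine hT a ⟨ha, ?_⟩ b ⟨hb, ?_⟩ c ⟨hc, ?_⟩ hab hac hbc
      · rintro rfl; exact hcon b hb c hc hab hac hbc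
      · rintro rfl; exact hcon a ha c hc hab.symm hbc hac
      · rintro rfl; exact hcon a ha b hb hac.symm hbc.symm hab
    by_cases hfar : ∃ x ∈ W, ∃ y ∈ W, x ≠ y ∧ ¬ G.Adj x y ∧ ∀ z ∈ W, G.Adj z x → ¬ G.Adj z y
    · obtain ⟨x, hx, y, hy, hxy, nxy, hn⟩ := hfar
      obtain ⟨X, S, D, E, h⟩ := hA.exists_isSplitObstruction hW hmin hT hx hy hxy nxy hn
      exact h.false hF hA
    · push Not at hfar
      refine hW (hF.hasTransversal_of_isPathFourFreeOn hA ?_ hmin)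
      intro p hp q hq r hr s hs hpq hqr hrs hpr hps hqs
      obtain ⟨e, -, hep, hes⟩ := hfar p hp s hs (by rintro rfl; exact hpr hrs.symm) hps
      exact hA.path_four hpq hqr hrs hpr hps hqs hep hes

theorem corollary2 {V : Type*} [Finite V] (G : SimpleGraph V) (hG : IsDistanceHereditary G) :
    IsTwoOneGraph G ↔
      IsInducedFree graphG1 G ∧ IsInducedFree graphG5 G ∧
        IsInducedFree graphG6 G ∧ IsInducedFree graphG7 G := by
  refine ⟨fun h => ⟨h.free_graphG1, h.free_graphG5, h.free_graphG6, h.free_graphG7⟩, ?_⟩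
  rintro ⟨h1, h5, h6, h7⟩
  obtain ⟨Q, -, hQ, hT⟩ := (forbidsObstructions_of_isInducedFree h1 h5 h6 h7).hasTransversal
    hG.hasUniformAttachment Set.univ
  have hfree : TriangleFreeOn G Qᶜ := fun a ha b hb c hc hab hac hbc =>
    (hT a trivial b trivial c trivial hab hac hbc).elim ha (Or.elim · hb hc)
  obtain ⟨A, B, hAB, hdisj, hA, hB⟩ := hG.exists_indep_partition hfree
  refine ⟨A, B, Q, by rw [hAB, Set.compl_union_self], hdisj, ?_, ?_, hA, hB, hQ⟩
  · exact (disjoint_compl_left (a := Q)).mono_left (hAB ▸ Set.subset_union_left)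
  · exact (disjoint_compl_left (a := Q)).mono_left (hAB ▸ Set.subset_union_right)
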